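/- Let $n\ge 0$, let $\kappa,\tilde\kappa>0$, and let $U\subset\mathbb R^{n+2}$ be a connected component of the set of configurations $(x,y,z)=(x,y,z_1,\dots,z_n)$ of $n+2$ distinct real points (that is, the order of the points on the line is prescribed). Write $z_{n+1}=\infty$, with the convention $1/(x-z_{n+1})=0$, write $\partial_i=\partial_{z_i}$, and for a function $g$ of $z=(z_1,\dots,z_n)$ put $\ell_x g(z)=\sum_{i=1}^n\frac{2}{z_i-x}\partial_i g(z)$. Let $h_1(x,z)$ and $h_2(y,z)$ be real functions, not assumed regular. Suppose that the system $$\frac{\kappa}{2}\partial_{xx}\psi+\sum_{i=1}^n\frac{2\,\partial_i\psi}{z_i-x}+\frac{2\,\partial_y\psi}{y-x}+\left(\left(1-\frac{6}{\tilde\kappa}\right)\frac{1}{(y-x)^2}+h_1(x,z)\right)\psi=0,$$ $$\frac{\tilde\kappa}{2}\partial_{yy}\psi+\sum_{i=1}^n\frac{2\,\partial_i\psi}{z_i-y}+\frac{2\,\partial_x\psi}{x-y}+\left(\left(1-\frac{6}{\kappa}\right)\frac{1}{(x-y)^2}+h_2(y,z)\right)\psi=0$$ has on $U$ a smooth, nowhere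 vanishing real solution $\psi$ that is invariant under translations $(x,y,z)\mapsto(x+c,y+c,z_1+c,\dots,z_n+c)$ and homogeneous of some real degree under dilations by positive factors. Then: 1. $\tilde\kappa=\kappa$ or $\tilde\kappa=16/\kappa$. 2. There are real constants $\nu_{ij}$, $1\le i<j\le n+1$, and a function $f(z_1,\dots,z_{n+1})$ of $n+1$ points of $\mathbb R\cup\{\infty\}$, invariant under the real Möbius transformations of positive determinant (the conformal automorphisms of the upper half-plane), such that $f(z_1,\dots,z_n,\infty)$ is positive and smooth on the projection of $U$ to the $z$-coordinates and such that, with $$h(x,z)=\sum_{1\le i<j\le n+1}2\nu_{ij}\left(\frac1{x-z_i}-\frac1{x-z_j}\right)^2+\ell_x\log f(z_1,\dots,z_n,\infty),$$ one has $h_1(x,z)=h(x,z)$ and $h_2(y,z)=h(y,z)$ for all $(x,y,z)\in U$. 3. The weight vector $(\nu_{ij})_{i<j}$ is well defined exactly modulo the relations $\nu_{ij}+\nu_{kl}=\nu_{il}+\nu_{jk}$: if $(\nu_{ij})$ is a weight vector as in 2 (for some $f$), then $(\nu'_{ij})$ is one as well (for some, possibly different, $f'$) if and only if $\nu'-\nu$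 lies in the linear span of the vectors $e_{ij}+e_{kl}-e_{il}-e_{jk}$ with $i,j,k,l\in\{1,\dots,n+1\}$ distinct, where $e_{ij}=e_{ji}$ denotes the basis vector of the unordered pair $\{i,j\}$. -/

import Mathlib

open scoped ContDiff

noncomputable section

namespace SLECommutation

/-- A configuration `(x, y, z)`: two growth points `x`, `y` and `n` further marked points
`z = (z₁, …, zₙ)` on the real line. The point at infinity is an additional marked point. -/
abbrev Config (n : ℕ) : Type := ℝ × ℝ × (Fin n → ℝ)

/-- The list `x, y, z₁, …, zₙ` of the finite points of a configuration. -/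
def pts {n : ℕ} (w : Config n) : Fin (n + 2) → ℝ :=
  Matrix.vecCons w.1 (Matrix.vecCons w.2.1 w.2.2)

/-- The configurations whose points lie on the line in the same order as those of `w₀`. When the
points of `w₀` are distinct, this is the connected component of `w₀` in the space of configurations
of distinct points. -/
def chamber {n : ℕ} (w₀ : Config n) : Set (Config n) :=
  {w | ∀ a b, pts w₀ a < pts w₀ b → pts w a < pts w b}

/-- The same for the marked points `z` alone. -/
def markedChamber {n : ℕ} (z₀ : Fin n → ℝ) : Set (Fin n → ℝ) :=
  {z | ∀ i j, z₀ i < z₀ j → z i < z j}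

/-- The partial derivative `∂_i g (z)` in the `i`-th marked point. -/
def pderiv {n : ℕ} (i : Fin n) (g : (Fin n → ℝ) → ℝ) (z : Fin n → ℝ) : ℝ :=
  deriv (fun t => g (Function.update z i t)) (z i)

/-- `∑ i, 2 / (z_i - x) ∂_i`, the part of the Loewner flow with singularity at `x` that acts on
the marked points `z`. -/
def markedFlow {n : ℕ} (x : ℝ) (g : (Fin n → ℝ) → ℝ) (z : Fin n → ℝ) : ℝ :=
  ∑ i, 2 / (z i - x) * pderiv i g z

/-- The operator `ℓ_x = 2 / (y - x) ∂_y + ∑ i, 2 / (z_i - x) ∂_i` acting on functions of `(y, z)`.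
On a function of `z` alone it is `markedFlow x`. -/
def ell {n : ℕ} (x : ℝ) (g : ℝ → (Fin n → ℝ) → ℝ) (y : ℝ) (z : Fin n → ℝ) : ℝ :=
  2 / (y - x) * deriv (fun t => g t z) y + markedFlow x (g y) z

/-- `ψ` solves, on the set `U`, the system of the two generators with zero-order terms
`(1 - 6 / κ') / (y - x) ^ 2 + h₁ (x, z)` and `(1 - 6 / κ) / (x - y) ^ 2 + h₂ (y, z)`. -/
def IsSolution {n : ℕ} (κ κ' : ℝ) (h₁ h₂ : ℝ → (Fin n → ℝ) → ℝ) (U : Set (Config n))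
    (ψ : Config n → ℝ) : Prop :=
  ∀ (x y : ℝ) (z : Fin n → ℝ), (x, y, z) ∈ U →
    κ / 2 * iteratedDeriv 2 (fun t => ψ (t, y, z)) x
        + ell x (fun t u => ψ (x, t, u)) y z
        + ((1 - 6 / κ') * (1 / (y - x) ^ 2) + h₁ x z) * ψ (x, y, z) = 0 ∧
    κ' / 2 * iteratedDeriv 2 (fun t => ψ (x, t, z)) y
        + ell y (fun t u => ψ (t, y, u)) x z
        + ((1 - 6 / κ) * (1 / (x - y) ^ 2) + h₂ y z) * ψ (x, y, z) = 0

/-- Index pairs `i < j` of the `n + 1` marked points `z₁, …, zₙ, zₙ₊₁ = ∞`. -/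
abbrev Pair (n : ℕ) : Type := {p : Fin (n + 1) × Fin (n + 1) // p.1 < p.2}

/-- The `n + 1` marked points `z₁, …, zₙ, zₙ₊₁ = ∞` on the boundary `ℝ ∪ {∞}` of the upper
half-plane. -/
def withInfty {n : ℕ} (z : Fin n → ℝ) : Fin (n + 1) → OnePoint ℝ :=
  Fin.snoc (α := fun _ => OnePoint ℝ) (fun i => (z i : OnePoint ℝ)) OnePoint.infty

/-- `1 / (x - z_i)` for `i = 1, …, n + 1`; it is `0` for `zₙ₊₁ = ∞`. -/
def recip {n : ℕ} (x : ℝ) (z : Fin n → ℝ) : Fin (n + 1) → ℝ :=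
  Fin.snoc (α := fun _ => ℝ) (fun i => 1 / (x - z i)) 0

/-- Invariance of a function of boundary points under the conformal automorphisms of the upper
half-plane, that is, the real Möbius transformations of positive determinant. -/
def ConformallyInvariant {m : ℕ} (f : (Fin m → OnePoint ℝ) → ℝ) : Prop :=
  ∀ g : GL (Fin 2) ℝ, 0 < g.det.val → ∀ p : Fin m → OnePoint ℝ, f (fun i => g • p i) = f p

/-- `h (x, z) = ∑ i < j, 2 ν_ij (1 / (x - z_i) - 1 / (x - z_j)) ^ 2 + ℓ_x (log f) (z)`. -/
def weight {n : ℕ} (ν : Pair n → ℝ) (f : (Fin (n + 1) → OnePoint ℝ) → ℝ)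
    (x : ℝ) (z : Fin n → ℝ) : ℝ :=
  ∑ p : Pair n, 2 * ν p * (recip x z p.1.1 - recip x z p.1.2) ^ 2
    + markedFlow x (fun u => Real.log (f (withInfty u))) z

/-- On the chamber of `w₀`, `h₁ (x, z) = h (x, z)` and `h₂ (y, z) = h (y, z)`, where `h` has weight
vector `ν` and some conformally invariant (positive, smooth) function `f` of the marked points. -/
def HasWeights {n : ℕ} (w₀ : Config n) (h₁ h₂ : ℝ → (Fin n → ℝ) → ℝ) (ν : Pair n → ℝ) : Prop :=
  ∃ f : (Fin (n + 1) → OnePoint ℝ) → ℝ,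
    ConformallyInvariant f ∧
    (∀ z ∈ markedChamber w₀.2.2, 0 < f (withInfty z)) ∧
    ContDiffOn ℝ ∞ (fun z : Fin n → ℝ => f (withInfty z)) (markedChamber w₀.2.2) ∧
    ∀ (x y : ℝ) (z : Fin n → ℝ), (x, y, z) ∈ chamber w₀ →
      h₁ x z = weight ν f x z ∧ h₂ y z = weight ν f y z

/-- The basis vector of the unordered pair `{i, j}`. -/
def basisVec {n : ℕ} (i j : Fin (n + 1)) : Pair n → ℝ :=
  fun p => if p.1 = (i, j) ∨ p.1 = (j, i) then 1 else 0

/-- The space spanned by the relations `ν_ij + ν_kl = ν_il + ν_jk`, with `i, j, k, l` distinct. -/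
def relations (n : ℕ) : Submodule ℝ (Pair n → ℝ) :=
  Submodule.span ℝ {v | ∃ i j k l : Fin (n + 1), [i, j, k, l].Nodup ∧
    v = basisVec i j + basisVec k l - basisVec i l - basisVec j k}

end SLECommutation

end

/-!
Write `M₁` and `M₂` for the two generators. The operator `[M₁, M₂] - 4 (y - x)⁻² (M₂ - M₁)` has
order zero, and it annihilates the nowhere vanishing solution `ψ`; so it is zero
(`ConfigAlgebra.commutation`). Translation invariance and homogeneity pass from `ψ` to the zero
order terms `h₁(x, z)` and `h₂(y, z)`, which become homogeneous of degree `-2`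
(`ConfigAlgebra.euler_zero_order`). These relations express `h₁`, `h₂`, `∂_x h₁` and `∂_y h₂`
through the derivatives in the marked points, and eliminating them from the commutation identity
leaves `∑ (z_i - y)² ∂_i h₂ / (z_i - x) - ∑ (z_i - x)² ∂_i h₁ / (z_i - y) = C / (x - y)²` with `C` a
multiple of `(κ' - κ) (κ κ' - 16)` (`separated_pointwise`). The coefficients of the first sum depend
on `y` and `z` only, those of the second on `x` and `z` only.

For fixed `z`, the left side is a kernel of finite rank in `x` and `y`, whereas `(x - y)⁻²` has
infinite rank on every pair of intervals. So `C = 0` (`double_pole_coeff_eq_zero`), which is the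
condition on `κ` and `κ'`. The two sums are then equal, so both are
`∑ m_ij(z) / ((z_i - x) (z_j - y))` for one matrix `m(z)` (`exists_pole_matrix`), which depends smoothly on `z` because it is
recovered from finitely many values by inverting a Cauchy matrix. Hence `h₁` and `h₂` are sums of
double and simple poles at the marked points. Differentiating these sums and comparing partial
fractions (`pderiv_coeffs`) shows that `m` is symmetric, that the double poles have constant
coefficients `α_i`, and that the residues of the simple poles form a closed one-form. The chamber is
convex, so the one-form has a primitive, and `h(x, z) = ∑ α_i / (x - z_i)² + ℓ_x L(z)` for both zero
order terms, with `L` translation invariant and `L(r z) = L(z) + e log r` (`exists_normalForm`).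

The weight function has the same shape: expanding the squares, the products of two simple poles are
the Loewner derivative `ℓ_x` of `2 ∑ ν_ij log |z_i - z_j|` (`weight_eq`). Therefore `ν` is a weight
vector if and only if the sums of its weights at the finite marked points are `α_i / 2` and its
total weight on the pairs of finite points is `e / 2` (`NormalForm.hasWeights_iff`). In that case
`f = exp (L - 2 ∑ ν_ij log |z_i - z_j|)` is invariant under affine maps, the stabilizer of `∞`, and
extends along Möbius orbits (`exists_conformallyInvariant`). The two conditions prescribe the vertex
sums of `ν` on the complete graph with vertices `z_1, …, z_n, ∞`. With three or more vertices this
is always possible (`exists_vertexSum`); with fewer, `e = 0` and the solution is immediate. Two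
solutions differ by a vector with zero vertex sums, and these are exactly the relations
`e_ij + e_kl - e_il - e_jk` (`mem_relations_iff`): a linear form that vanishes on the relations is of the form
`e_ij ↦ c_i + c_j` (`exists_potential_of_fourPoint`).
-/

namespace SLECommutation

open TopologicalSpace Topology

/-! ### Linear independence of pole terms -/

/-- A nonzero combination of the `card ι + 1` kernels `1 / (p - t_l)` vanishes at all nodes `p_i`,
by counting dimensions. -/
theorem exists_annihilator {ι : Type*} [Fintype ι] (p : ι → ℝ) (t : Option ι → ℝ) :
    ∃ w : Option ι → ℝ, w ≠ 0 ∧ ∀ i, ∑ l, w l / (p i - t l) = 0 := by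
  let f : (Option ι → ℝ) →ₗ[ℝ] (ι → ℝ) :=
    { toFun := fun w i => ∑ l, w l / (p i - t l)
      map_add' := fun v w => by
        funext i; simp only [Pi.add_apply, add_div, Finset.sum_add_distrib]
      map_smul' := fun c w => by
        funext i
        simp only [Pi.smul_apply, smul_eq_mul, mul_div_assoc, Finset.mul_sum, RingHom.id_apply] }
  have : LinearMap.ker f ≠ ⊥ := LinearMap.ker_ne_bot_of_finrank_lt (by simp)
  obtain ⟨w, hw, hw0⟩ := Submodule.exists_mem_ne_zero_of_ne_bot this
  exact ⟨w, hw0, fun i => congrFun (LinearMap.mem_ker.1 hw) i⟩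

section Poles

open Polynomial

variable {ι : Type*} [Fintype ι] [DecidableEq ι]

/-- Partial fraction terms of order `1, …, N` at distinct points are linearly independent on every
infinite set. -/
theorem pole_independent {p : ι → ℝ} (hp : Function.Injective p) {S : Set ℝ} (hS : S.Infinite)
    (hSp : ∀ t ∈ S, ∀ i, t ≠ p i) (N : ℕ) (a : ι → ℕ → ℝ)
    (h : ∀ t ∈ S, ∑ i, ∑ s ∈ Finset.range N, a i s / (t - p i) ^ (s + 1) = 0) :
    ∀ i, ∀ s < N, a i s = 0 := by
  induction N with
  | zero => intro i s hs; omega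
  | succ N ih =>
    have top : ∀ i, a i N = 0 := by
      -- After clearing denominators, only the leading term at `p i` survives at `X = p i`.
      set Q : ℝ[X] := ∑ i, ∑ s ∈ Finset.range (N + 1), C (a i s) * (X - C (p i)) ^ (N - s) *
        ∏ j ∈ Finset.univ.erase i, (X - C (p j)) ^ (N + 1) with hQ
      have hQ0 : Q = 0 := by
        refine Polynomial.eq_zero_of_infinite_isRoot Q (hS.mono fun t ht => ?_)
        have e : Q.eval t = (∑ i, ∑ s ∈ Finset.range (N + 1), a i s / (t - p i) ^ (s + 1)) *
            ∏ j, (t - p j) ^ (N + 1) := by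
          rw [hQ, Polynomial.eval_finsetSum, Finset.sum_mul]
          refine Finset.sum_congr rfl fun i _ => ?_
          rw [Polynomial.eval_finsetSum, Finset.sum_mul]
          refine Finset.sum_congr rfl fun s hs => ?_
          rw [← Finset.mul_prod_erase Finset.univ _ (Finset.mem_univ i)]
          have hne : t - p i ≠ 0 := sub_ne_zero.2 (hSp t ht i)
          have hs' : N + 1 = (N - s) + (s + 1) := by
            have := Finset.mem_range.1 hs; omega
          have : (t - p i) ^ (N + 1) = (t - p i) ^ (N - s) * (t - p i) ^ (s + 1) := by
            rw [← pow_add, ← hs']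
          rw [this]
          simp only [eval_mul, eval_C, eval_pow, eval_sub, eval_X, Polynomial.eval_prod]
          field_simp
        simp only [Set.mem_ofPred_eq, IsRoot, e, h t ht, zero_mul]
      intro i
      have e : Q.eval (p i) = a i N * ∏ j ∈ Finset.univ.erase i, (p i - p j) ^ (N + 1) := by
        rw [hQ, Polynomial.eval_finsetSum, Finset.sum_eq_single i]
        · rw [Polynomial.eval_finsetSum, Finset.sum_eq_single N]
          · simp [Polynomial.eval_prod]
          · intro s hs hsN
            have : N - s ≠ 0 := by have := Finset.mem_range.1 hs; omega
            simp [this]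
          · simp
        · intro j _ hji
          rw [Polynomial.eval_finsetSum]
          refine Finset.sum_eq_zero fun s _ => ?_
          have : ∏ k ∈ Finset.univ.erase j, (p i - p k) ^ (N + 1) = 0 :=
            Finset.prod_eq_zero (Finset.mem_erase.2 ⟨hji.symm, Finset.mem_univ i⟩) (by simp)
          simp [Polynomial.eval_prod, this]
        · simp
      rw [hQ0, eval_zero] at e
      refine (mul_eq_zero.1 e.symm).resolve_right (Finset.prod_ne_zero_iff.2 fun j hj => ?_)
      exact pow_ne_zero _ (sub_ne_zero.2 fun hij => (Finset.mem_erase.1 hj).1 (hp hij).symm)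
    intro i s hs
    rcases Nat.lt_succ_iff_lt_or_eq.1 hs with hs | rfl
    · refine ih (fun t ht => ?_) i s hs
      rw [← h t ht]
      refine Finset.sum_congr rfl fun i _ => ?_
      rw [Finset.sum_range_succ, top i]
      simp
    · exact top i

theorem simple_pole_independent {p : ι → ℝ} (hp : Function.Injective p) {S : Set ℝ}
    (hS : S.Infinite) (hSp : ∀ t ∈ S, ∀ i, t ≠ p i) {a b : ι → ℝ}
    (h : ∀ t ∈ S, ∑ i, a i / (p i - t) = ∑ i, b i / (p i - t)) : a = b := by
  have := pole_independent hp hS hSp 1 (fun i _ => a i - b i) (fun t ht => by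
    have e := h t ht
    rw [← sub_eq_zero, ← Finset.sum_sub_distrib] at e
    rw [← neg_eq_zero, ← e, ← Finset.sum_neg_distrib]
    refine Finset.sum_congr rfl fun i _ => ?_
    have h1 : t - p i ≠ 0 := sub_ne_zero.2 (hSp t ht i)
    have h2 : p i - t ≠ 0 := sub_ne_zero.2 (hSp t ht i).symm
    rw [Finset.sum_range_one]
    field_simp
    ring)
  funext i
  exact sub_eq_zero.1 (this i 0 one_pos)

/-- The Cauchy matrix `1 / (p_i - t_k)`, rows indexed by the nodes `t_k`. -/
noncomputable def cauchy (p t : ι → ℝ) : Matrix ι ι ℝ := Matrix.of fun k i => 1 / (p i - t k)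

/-- A kernel vector would be the coefficients of a sum of simple poles with `card ι` zeros, whose
numerator has degree less than `card ι`. -/
theorem cauchy_det_ne_zero {p t : ι → ℝ} (hp : Function.Injective p) (ht : Function.Injective t)
    (hpt : ∀ i k, p i ≠ t k) : (cauchy p t).det ≠ 0 := by
  intro hdet
  obtain ⟨a, ha, h0⟩ := Matrix.exists_mulVec_eq_zero_iff.2 hdet
  obtain ⟨i, hi⟩ := Function.ne_iff.1 ha
  set Q : ℝ[X] := ∑ i, C (a i) * ∏ j ∈ Finset.univ.erase i, (X - C (p j)) with hQ
  have hQ0 : Q = 0 := by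
    refine Polynomial.eq_zero_of_natDegree_lt_card_of_eval_eq_zero Q ht (fun k => ?_) ?_
    · have e : Q.eval (t k) = -(∑ i, 1 / (p i - t k) * a i) * ∏ j, (t k - p j) := by
        rw [hQ, Polynomial.eval_finsetSum, ← Finset.sum_neg_distrib, Finset.sum_mul]
        refine Finset.sum_congr rfl fun i _ => ?_
        rw [← Finset.mul_prod_erase Finset.univ _ (Finset.mem_univ i)]
        have : p i - t k ≠ 0 := sub_ne_zero.2 (hpt i k)
        simp only [eval_mul, eval_C, eval_sub, eval_X, Polynomial.eval_prod]
        field_simp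
        ring
      have := congrFun h0 k
      simp only [Matrix.mulVec, dotProduct, cauchy, Matrix.of_apply, Pi.zero_apply] at this
      rw [e, this]
      simp
    · have hpos : 0 < Fintype.card ι := Fintype.card_pos_iff.2 ⟨i⟩
      have : Q.natDegree ≤ Fintype.card ι - 1 := by
        refine Polynomial.natDegree_sum_le_of_forall_le _ _ fun j _ => ?_
        refine (Polynomial.natDegree_C_mul_le _ _).trans ?_
        rw [Polynomial.natDegree_prod_of_monic _ _ fun k _ => monic_X_sub_C _]
        simp [Finset.card_erase_of_mem]
      omega
  have e : Q.eval (p i) = a i * ∏ j ∈ Finset.univ.erase i, (p i - p j) := by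
    rw [hQ, Polynomial.eval_finsetSum, Finset.sum_eq_single i]
    · simp [Polynomial.eval_prod]
    · intro j _ hji
      have : ∏ k ∈ Finset.univ.erase j, (p i - p k) = 0 :=
        Finset.prod_eq_zero (Finset.mem_erase.2 ⟨hji.symm, Finset.mem_univ i⟩) (by simp)
      simp [Polynomial.eval_prod, this]
    · simp
  rw [hQ0, eval_zero] at e
  rcases mul_eq_zero.1 e.symm with h | h
  · exact hi h
  · obtain ⟨j, hj, hj0⟩ := Finset.prod_eq_zero_iff.1 h
    exact (Finset.mem_erase.1 hj).1 (hp (sub_eq_zero.1 hj0)).symm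

/-- The coefficients of a sum of simple poles, recovered from its values at `card ι` nodes. -/
theorem eq_cauchy_inv_sum {p t : ι → ℝ} (hp : Function.Injective p) (ht : Function.Injective t)
    (hpt : ∀ i k, p i ≠ t k) {a r : ι → ℝ} (h : ∀ k, r k = ∑ i, a i / (p i - t k)) (i : ι) :
    a i = ∑ k, (cauchy p t)⁻¹ i k * r k := by
  have hr : r = (cauchy p t).mulVec a := by
    funext k
    rw [h k]
    simp only [Matrix.mulVec, dotProduct, cauchy, Matrix.of_apply]
    exact Finset.sum_congr rfl fun i _ => by ring
  have hu : IsUnit (cauchy p t).det := (cauchy_det_ne_zero hp ht hpt).isUnit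
  have : (cauchy p t)⁻¹.mulVec r = a := by
    rw [hr, Matrix.mulVec_mulVec, Matrix.nonsing_inv_mul _ hu, Matrix.one_mulVec]
  rw [← this]
  rfl

/-- The kernel `(y - x)⁻²` has infinite rank, so it is not a combination of simple poles at
finitely many points with coefficients depending on one variable each. -/
theorem double_pole_coeff_eq_zero {p : ι → ℝ} (hp : Function.Injective p) {I J : Set ℝ}
    (hI : I.Infinite) (hJ : J.Infinite) (hIp : ∀ t ∈ I, ∀ i, t ≠ p i) (hJp : ∀ t ∈ J, ∀ i, t ≠ p i)
    (hIJ : ∀ x ∈ I, ∀ y ∈ J, x ≠ y) {G K : ι → ℝ → ℝ} {c : ℝ}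
    (h : ∀ x ∈ I, ∀ y ∈ J, ∑ i, G i y / (p i - x) - ∑ i, K i x / (p i - y) = c / (x - y) ^ 2) :
    c = 0 := by
  obtain ⟨t, htJ, ht⟩ : ∃ t : Option ι → ℝ, (∀ l, t l ∈ J) ∧ Function.Injective t := by
    let e := hJ.natEmbedding
    refine ⟨fun l => e (Fintype.equivFin (Option ι) l), fun l => (e _).2, fun l l' hl => ?_⟩
    exact (Fintype.equivFin (Option ι)).injective (Fin.ext (e.injective (Subtype.ext hl)))
  -- Applying `w` to the nodes `t` in `J` removes the terms with poles in `y`. What remains has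
  -- simple poles at the `p i`, but double poles at the `t l` with coefficients `w l * c`.
  obtain ⟨w, hw, hw0⟩ := exists_annihilator p t
  obtain ⟨l, hl⟩ := Function.ne_iff.1 hw
  have hq : Function.Injective (Sum.elim p t) :=
    hp.sumElim ht fun i k => (hJp _ (htJ k) i).symm
  have key := pole_independent hq hI
    (fun x hx => by
      rintro (i | k)
      · exact hIp x hx i
      · exact hIJ x hx _ (htJ k)) 2
    (Sum.elim (fun i s => if s = 0 then ∑ l, w l * G i (t l) else 0)
      (fun k s => if s = 1 then w k * c else 0))
    (fun x hx => by
      have e : ∑ l, w l * (∑ i, G i (t l) / (p i - x) - ∑ i, K i x / (p i - t l)) =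
          ∑ l, w l * (c / (x - t l) ^ 2) :=
        Finset.sum_congr rfl fun l _ => by rw [h x hx _ (htJ l)]
      have e1 : ∑ l, w l * ∑ i, K i x / (p i - t l) = 0 := by
        simp only [Finset.mul_sum]
        rw [Finset.sum_comm]
        refine Finset.sum_eq_zero fun i _ => ?_
        have : ∀ l, w l * (K i x / (p i - t l)) = K i x * (w l / (p i - t l)) := fun l => by ring
        simp only [this, ← Finset.mul_sum, hw0 i, mul_zero]
      have e2 : ∑ l, w l * ∑ i, G i (t l) / (p i - x) =
          ∑ i, (∑ l, w l * G i (t l)) / (p i - x) := by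
        simp only [Finset.mul_sum, Finset.sum_div]
        rw [Finset.sum_comm]
        simp only [mul_div_assoc]
      simp only [mul_sub, Finset.sum_sub_distrib, e1, e2, sub_zero] at e
      have e3 : ∀ i, (∑ l, w l * G i (t l)) / (x - p i) = -((∑ l, w l * G i (t l)) / (p i - x)) :=
        fun i => by rw [← neg_sub (p i) x, div_neg]
      simp [Fintype.sum_sum_type, Finset.sum_range_succ, e3, mul_div_assoc, e, -Fintype.sum_option])
  have := key (Sum.inr l) 1 one_lt_two
  simp only [Sum.elim_inr, if_true] at this
  exact (mul_eq_zero.1 this).resolve_left hl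

/-- A bilinear identity between simple poles in `x` and in `y` forces both sides to be given by one
matrix. -/
theorem exists_pole_matrix {p : ι → ℝ} (hp : Function.Injective p) {I J : Set ℝ}
    (hI : I.Infinite) (hJ : J.Infinite) (hIp : ∀ t ∈ I, ∀ i, t ≠ p i) (hJp : ∀ t ∈ J, ∀ i, t ≠ p i)
    {G K : ι → ℝ → ℝ}
    (h : ∀ x ∈ I, ∀ y ∈ J, ∑ i, G i y / (p i - x) = ∑ i, K i x / (p i - y)) :
    ∃ m : ι → ι → ℝ, (∀ y ∈ J, ∀ i, G i y = ∑ j, m i j / (p j - y)) ∧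
      ∀ x ∈ I, ∀ j, K j x = ∑ i, m i j / (p i - x) := by
  obtain ⟨t, htI, ht⟩ : ∃ t : ι → ℝ, (∀ l, t l ∈ I) ∧ Function.Injective t := by
    let e := hI.natEmbedding
    refine ⟨fun l => e (Fintype.equivFin ι l), fun l => (e _).2, fun l l' hl => ?_⟩
    exact (Fintype.equivFin ι).injective (Fin.ext (e.injective (Subtype.ext hl)))
  have hpt : ∀ i k, p i ≠ t k := fun i k => (hIp _ (htI k) i).symm
  -- Solving the identity at `card ι` values of `x` for `G` shows that `G` is a sum of simple poles.
  have hG : ∀ y ∈ J, ∀ i, G i y =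
      ∑ j, (∑ k, (cauchy p t)⁻¹ i k * K j (t k)) / (p j - y) := fun y hy i => by
    rw [eq_cauchy_inv_sum hp ht hpt (r := fun k => ∑ i, K i (t k) / (p i - y))
      (fun k => (h _ (htI k) y hy).symm) i]
    simp only [Finset.mul_sum, Finset.sum_div]
    rw [Finset.sum_comm]
    simp only [mul_div_assoc]
  refine ⟨fun i j => ∑ k, (cauchy p t)⁻¹ i k * K j (t k), hG, fun x hx j => ?_⟩
  refine congrFun (simple_pole_independent hp hJ hJp (a := fun j => K j x)
    (b := fun j => ∑ i, (∑ k, (cauchy p t)⁻¹ i k * K j (t k)) / (p i - x)) fun y hy => ?_) j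
  rw [← h x hx y hy]
  simp only [hG y hy, Finset.sum_div]
  rw [Finset.sum_comm]
  exact Finset.sum_congr rfl fun i _ => Finset.sum_congr rfl fun j _ =>
    Finset.sum_congr rfl fun k _ => div_right_comm _ _ _

end Poles

/-! ### The commutation identity -/

/-- An algebra of functions of a configuration `(x, y, z)` of distinct points: commuting partial
derivatives `dx`, `dy`, `dz i`, the coordinates `X`, `Y`, `Z i`, and the inverses
`δ = 1 / (y - x)`, `a i = 1 / (z i - x)`, `b i = 1 / (z i - y)`. -/
structure ConfigAlgebra (n : ℕ) (R : Type*) [CommRing R] [Algebra ℝ R] where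
  dx : Derivation ℝ R R
  dy : Derivation ℝ R R
  dz : Fin n → Derivation ℝ R R
  dx_dy : ∀ f, dx (dy f) = dy (dx f)
  dx_dz : ∀ i f, dx (dz i f) = dz i (dx f)
  dy_dz : ∀ i f, dy (dz i f) = dz i (dy f)
  dz_dz : ∀ i j f, dz i (dz j f) = dz j (dz i f)
  X : R
  Y : R
  Z : Fin n → R
  dx_X : dx X = 1
  dx_Y : dx Y = 0
  dx_Z : ∀ i, dx (Z i) = 0
  dy_X : dy X = 0
  dy_Y : dy Y = 1
  dy_Z : ∀ i, dy (Z i) = 0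
  dz_X : ∀ i, dz i X = 0
  dz_Y : ∀ i, dz i Y = 0
  dz_Z : ∀ i j, dz i (Z j) = if i = j then 1 else 0
  δ : R
  a : Fin n → R
  b : Fin n → R
  δ_mul : δ * (Y - X) = 1
  a_mul : ∀ i, a i * (Z i - X) = 1
  b_mul : ∀ i, b i * (Z i - Y) = 1

theorem derivation_inv {R : Type*} [CommRing R] [Algebra ℝ R] (D : Derivation ℝ R R) {u v : R}
    (h : u * v = 1) : D u = -(u ^ 2 * D v) := by
  have e : D (u * v) = 0 := by rw [h, D.map_one_eq_zero]
  rw [D.leibniz, smul_eq_mul, smul_eq_mul] at e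
  linear_combination u * e - D u * h

namespace ConfigAlgebra

variable {n : ℕ} {R : Type*} [CommRing R] [Algebra ℝ R] (A : ConfigAlgebra n R)

theorem dx_δ : A.dx A.δ = A.δ ^ 2 := by
  rw [derivation_inv _ A.δ_mul, map_sub, A.dx_X, A.dx_Y]; ring

theorem dy_δ : A.dy A.δ = -A.δ ^ 2 := by
  rw [derivation_inv _ A.δ_mul, map_sub, A.dy_X, A.dy_Y]; ring

theorem dz_δ (i : Fin n) : A.dz i A.δ = 0 := by
  rw [derivation_inv _ A.δ_mul, map_sub, A.dz_X, A.dz_Y]; ring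

theorem dx_a (i : Fin n) : A.dx (A.a i) = A.a i ^ 2 := by
  rw [derivation_inv _ (A.a_mul i), map_sub, A.dx_X, A.dx_Z]; ring

theorem dy_a (i : Fin n) : A.dy (A.a i) = 0 := by
  rw [derivation_inv _ (A.a_mul i), map_sub, A.dy_X, A.dy_Z]; ring

theorem dz_a (i j : Fin n) : A.dz i (A.a j) = if i = j then -A.a j ^ 2 else 0 := by
  rw [derivation_inv _ (A.a_mul j), map_sub, A.dz_X, A.dz_Z]; split_ifs <;> ring

theorem dx_b (i : Fin n) : A.dx (A.b i) = 0 := by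
  rw [derivation_inv _ (A.b_mul i), map_sub, A.dx_Y, A.dx_Z]; ring

theorem dy_b (i : Fin n) : A.dy (A.b i) = A.b i ^ 2 := by
  rw [derivation_inv _ (A.b_mul i), map_sub, A.dy_Y, A.dy_Z]; ring

theorem dz_b (i j : Fin n) : A.dz i (A.b j) = if i = j then -A.b j ^ 2 else 0 := by
  rw [derivation_inv _ (A.b_mul j), map_sub, A.dz_Y, A.dz_Z]; split_ifs <;> ring

/-- `∑ i, 2 / (z_i - x) ∂_i`. -/
def lx (f : R) : R := ∑ i, 2 * A.a i * A.dz i f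

/-- `∑ i, 2 / (z_i - y) ∂_i`. -/
def ly (f : R) : R := ∑ i, 2 * A.b i * A.dz i f

/-- The first order part `2 / (y - x) ∂_y + ∑ i, 2 / (z_i - x) ∂_i` of the first generator. -/
def V (f : R) : R := A.lx f + 2 * A.δ * A.dy f

/-- The first order part `2 / (x - y) ∂_x + ∑ i, 2 / (z_i - y) ∂_i` of the second generator. -/
def W (f : R) : R := A.ly f - 2 * A.δ * A.dx f

theorem lx_add (f g : R) : A.lx (f + g) = A.lx f + A.lx g := by
  simp only [lx, map_add, mul_add, Finset.sum_add_distrib]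

theorem ly_add (f g : R) : A.ly (f + g) = A.ly f + A.ly g := by
  simp only [ly, map_add, mul_add, Finset.sum_add_distrib]

theorem lx_mul (f g : R) : A.lx (f * g) = f * A.lx g + g * A.lx f := by
  simp only [lx, Derivation.leibniz, smul_eq_mul, Finset.mul_sum, ← Finset.sum_add_distrib]
  exact Finset.sum_congr rfl fun i _ => by ring

theorem ly_mul (f g : R) : A.ly (f * g) = f * A.ly g + g * A.ly f := by
  simp only [ly, Derivation.leibniz, smul_eq_mul, Finset.mul_sum, ← Finset.sum_add_distrib]
  exact Finset.sum_congr rfl fun i _ => by ring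

theorem V_add (f g : R) : A.V (f + g) = A.V f + A.V g := by
  simp only [V, lx_add, map_add]; ring

theorem W_add (f g : R) : A.W (f + g) = A.W f + A.W g := by
  simp only [W, ly_add, map_add]; ring

theorem V_mul (f g : R) : A.V (f * g) = f * A.V g + g * A.V f := by
  simp only [V, lx_mul, Derivation.leibniz, smul_eq_mul]; ring

theorem W_mul (f g : R) : A.W (f * g) = f * A.W g + g * A.W f := by
  simp only [W, ly_mul, Derivation.leibniz, smul_eq_mul]; ring

theorem V_zero : A.V 0 = 0 := by simp [V, lx]

theorem W_zero : A.W 0 = 0 := by simp [W, ly]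

theorem V_algebraMap (r : ℝ) : A.V (algebraMap ℝ R r) = 0 := by simp [V, lx]

theorem W_algebraMap (r : ℝ) : A.W (algebraMap ℝ R r) = 0 := by simp [W, ly]

theorem V_δ : A.V A.δ = -2 * A.δ ^ 3 := by
  simp only [V, lx, dz_δ, dy_δ, mul_zero, Finset.sum_const_zero]; ring

theorem W_δ : A.W A.δ = -2 * A.δ ^ 3 := by
  simp only [W, ly, dz_δ, dx_δ, mul_zero, Finset.sum_const_zero]; ring

theorem derivation_two (D : Derivation ℝ R R) : D (2 : R) = 0 := by
  have : (2 : R) = algebraMap ℝ R 2 := (map_ofNat _ 2).symm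
  rw [this, D.map_algebraMap]

theorem dx_lx (f : R) :
    A.dx (A.lx f) = A.lx (A.dx f) + ∑ i, 2 * A.a i ^ 2 * A.dz i f := by
  simp only [lx, map_sum, Derivation.leibniz, smul_eq_mul, dx_a, dx_dz, derivation_two,
    ← Finset.sum_add_distrib]
  exact Finset.sum_congr rfl fun i _ => by ring

theorem dy_lx (f : R) : A.dy (A.lx f) = A.lx (A.dy f) := by
  simp only [lx, map_sum, Derivation.leibniz, smul_eq_mul, dy_a, dy_dz, derivation_two]
  exact Finset.sum_congr rfl fun i _ => by ring

theorem dy_ly (f : R) :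
    A.dy (A.ly f) = A.ly (A.dy f) + ∑ i, 2 * A.b i ^ 2 * A.dz i f := by
  simp only [ly, map_sum, Derivation.leibniz, smul_eq_mul, dy_b, dy_dz, derivation_two,
    ← Finset.sum_add_distrib]
  exact Finset.sum_congr rfl fun i _ => by ring

theorem dx_ly (f : R) : A.dx (A.ly f) = A.ly (A.dx f) := by
  simp only [ly, map_sum, Derivation.leibniz, smul_eq_mul, dx_b, dx_dz, derivation_two]
  exact Finset.sum_congr rfl fun i _ => by ring

theorem dx_W (f : R) : A.dx (A.W f) = A.W (A.dx f) - 2 * A.δ ^ 2 * A.dx f := by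
  simp only [W, map_sub, dx_ly, Derivation.leibniz, smul_eq_mul, dx_δ, derivation_two]; ring

theorem dy_V (f : R) : A.dy (A.V f) = A.V (A.dy f) - 2 * A.δ ^ 2 * A.dy f := by
  simp only [V, map_add, dy_lx, Derivation.leibniz, smul_eq_mul, dy_δ, derivation_two]; ring

theorem lx_ly_comm (f : R) : A.lx (A.ly f) - A.ly (A.lx f) =
    ∑ i, 4 * A.a i * A.b i * (A.a i - A.b i) * A.dz i f := by
  have e1 : A.lx (A.ly f) = (∑ i, ∑ j, 4 * A.a i * A.b j * A.dz i (A.dz j f)) +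
      ∑ i, 2 * A.a i * (-2 * A.b i ^ 2) * A.dz i f := by
    simp only [lx, ly, map_sum, Derivation.leibniz, smul_eq_mul, dz_b, derivation_two,
      ← Finset.sum_add_distrib, Finset.mul_sum]
    refine Finset.sum_congr rfl fun i _ => ?_
    have : 2 * A.a i * (-2 * A.b i ^ 2) * A.dz i f =
        ∑ j, if i = j then 2 * A.a i * (-2 * A.b j ^ 2) * A.dz j f else 0 := by simp
    rw [this, ← Finset.sum_add_distrib]
    refine Finset.sum_congr rfl fun j _ => ?_
    split_ifs <;> ring
  have e2 : A.ly (A.lx f) = (∑ i, ∑ j, 4 * A.b i * A.a j * A.dz i (A.dz j f)) +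
      ∑ i, 2 * A.b i * (-2 * A.a i ^ 2) * A.dz i f := by
    simp only [lx, ly, map_sum, Derivation.leibniz, smul_eq_mul, dz_a, derivation_two,
      ← Finset.sum_add_distrib, Finset.mul_sum]
    refine Finset.sum_congr rfl fun i _ => ?_
    have : 2 * A.b i * (-2 * A.a i ^ 2) * A.dz i f =
        ∑ j, if i = j then 2 * A.b i * (-2 * A.a j ^ 2) * A.dz j f else 0 := by simp
    rw [this, ← Finset.sum_add_distrib]
    refine Finset.sum_congr rfl fun j _ => ?_
    split_ifs <;> ring
  have e3 : ∑ i, ∑ j, 4 * A.a i * A.b j * A.dz i (A.dz j f) =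
      ∑ i, ∑ j, 4 * A.b i * A.a j * A.dz i (A.dz j f) := by
    rw [Finset.sum_comm]
    refine Finset.sum_congr rfl fun i _ => Finset.sum_congr rfl fun j _ => ?_
    rw [A.dz_dz]; ring
  rw [e1, e2, e3, add_sub_add_left_eq_sub, ← Finset.sum_sub_distrib]
  exact Finset.sum_congr rfl fun i _ => by ring

theorem δ_mul_sub (i : Fin n) : A.δ * (A.b i - A.a i) = A.a i * A.b i := by
  linear_combination A.a i * A.b i * A.δ_mul + A.δ * A.a i * A.b_mul i - A.δ * A.b i * A.a_mul i

/-- The first order parts of the generators commute up to first order terms singular at `x = y`. -/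
theorem V_W_comm (f : R) : A.V (A.W f) - A.W (A.V f) =
    4 * A.δ ^ 2 * (A.W f - A.V f) + 12 * A.δ ^ 3 * (A.dx f + A.dy f) := by
  have hs : (∑ i, 4 * A.a i * A.b i * (A.a i - A.b i) * A.dz i f) +
      2 * A.δ * (∑ i, 2 * A.b i ^ 2 * A.dz i f) + 2 * A.δ * (∑ i, 2 * A.a i ^ 2 * A.dz i f) =
      4 * A.δ ^ 2 * (A.ly f - A.lx f) := by
    simp only [lx, ly, Finset.mul_sum, ← Finset.sum_add_distrib, ← Finset.sum_sub_distrib]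
    refine Finset.sum_congr rfl fun i _ => ?_
    linear_combination ((A.b i - A.a i) * 4 - 8 * A.δ) * A.dz i f * A.δ_mul_sub i
  have hc := A.lx_ly_comm f
  have e1 : A.V (A.W f) = A.lx (A.ly f) - 2 * A.δ * A.lx (A.dx f) + 2 * A.δ * (A.ly (A.dy f) +
      ∑ i, 2 * A.b i ^ 2 * A.dz i f) - 2 * A.δ * (2 * A.δ * A.dx (A.dy f)
        - 2 * A.δ ^ 2 * A.dx f) := by
    have : A.lx (A.ly f - 2 * A.δ * A.dx f) = A.lx (A.ly f) - 2 * A.δ * A.lx (A.dx f) := by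
      simp only [lx, map_sub, Derivation.leibniz, smul_eq_mul, dz_δ, derivation_two,
        Finset.mul_sum, ← Finset.sum_sub_distrib]
      exact Finset.sum_congr rfl fun i _ => by ring
    rw [V, W, this, map_sub, dy_ly]
    simp only [Derivation.leibniz, smul_eq_mul, dy_δ, derivation_two, dx_dy]
    ring
  have e2 : A.W (A.V f) = A.ly (A.lx f) + 2 * A.δ * A.ly (A.dy f) - 2 * A.δ * (A.lx (A.dx f) +
      ∑ i, 2 * A.a i ^ 2 * A.dz i f) - 2 * A.δ * (2 * A.δ * A.dx (A.dy f)
        + 2 * A.δ ^ 2 * A.dy f) := by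
    have : A.ly (A.lx f + 2 * A.δ * A.dy f) = A.ly (A.lx f) + 2 * A.δ * A.ly (A.dy f) := by
      simp only [ly, map_add, Derivation.leibniz, smul_eq_mul, dz_δ, derivation_two,
        Finset.mul_sum, ← Finset.sum_add_distrib]
      exact Finset.sum_congr rfl fun i _ => by ring
    rw [W, V, this, map_add, dx_lx]
    simp only [Derivation.leibniz, smul_eq_mul, dx_δ, derivation_two]
    ring
  rw [e1, e2, W, V]
  linear_combination hc + hs

/-- The zero order part of the commutator of the two generators vanishes, as it annihilates the
nowhere vanishing common solution `ψ`. The operator annihilating `ψ` is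
`[M₁, M₂] - 4 (y - x)⁻² (M₂ - M₁)`, where `M₁` and `M₂` are the two generators. -/
theorem commutation {κ κ' : ℝ} (hκ : κ ≠ 0) (hκ' : κ' ≠ 0) {h₁ h₂ ψ : R} (hψ : IsUnit ψ)
    (hy : A.dy h₁ = 0) (hx : A.dx h₂ = 0)
    (e₁ : algebraMap ℝ R (κ / 2) * A.dx (A.dx ψ) + A.V ψ +
      (algebraMap ℝ R (1 - 6 / κ') * A.δ ^ 2 + h₁) * ψ = 0)
    (e₂ : algebraMap ℝ R (κ' / 2) * A.dy (A.dy ψ) + A.W ψ +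
      (algebraMap ℝ R (1 - 6 / κ) * A.δ ^ 2 + h₂) * ψ = 0) :
    algebraMap ℝ R (3 * (κ - κ') + 48 * (1 / κ - 1 / κ')) * A.δ ^ 4 + A.V h₂ - A.W h₁ -
      4 * A.δ ^ 2 * (h₂ - h₁) = 0 := by
  -- The constants are abstracted to elements of `R`, subject only to `hkq` and `hkp`.
  obtain ⟨k, hk⟩ : ∃ k, k = algebraMap ℝ R (κ / 2) := ⟨_, rfl⟩
  obtain ⟨k', hk'⟩ : ∃ k, k = algebraMap ℝ R (κ' / 2) := ⟨_, rfl⟩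
  obtain ⟨p, hp⟩ : ∃ k, k = algebraMap ℝ R (1 - 6 / κ') := ⟨_, rfl⟩
  obtain ⟨q, hq⟩ : ∃ k, k = algebraMap ℝ R (1 - 6 / κ) := ⟨_, rfl⟩
  have hc : algebraMap ℝ R (3 * (κ - κ') + 48 * (1 / κ - 1 / κ')) = 6 * (k - k') + 8 * (p - q) := by
    have : 3 * (κ - κ') + 48 * (1 / κ - 1 / κ') =
        6 * (κ / 2 - κ' / 2) + 8 * ((1 - 6 / κ') - (1 - 6 / κ)) := by ring
    rw [this, hk, hk', hp, hq]
    simp only [map_add, map_mul, map_sub, map_ofNat]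
  have hkq : k * q = k - 3 := by
    have : κ / 2 * (1 - 6 / κ) = κ / 2 - 3 := by field_simp; ring
    rw [hk, hq, ← map_mul, this, map_sub, map_ofNat]
  have hkp : k' * p = k' - 3 := by
    have : κ' / 2 * (1 - 6 / κ') = κ' / 2 - 3 := by field_simp; ring
    rw [hk', hp, ← map_mul, this, map_sub, map_ofNat]
  have kill : ∀ D : Derivation ℝ R R, D k = 0 ∧ D k' = 0 ∧ D p = 0 ∧ D q = 0 := fun D => by
    simp only [hk, hk', hp, hq, Derivation.map_algebraMap, and_self]
  have killV : A.V k = 0 ∧ A.V k' = 0 ∧ A.V p = 0 ∧ A.V q = 0 := by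
    simp only [hk, hk', hp, hq, V_algebraMap, and_self]
  have killW : A.W k = 0 ∧ A.W k' = 0 ∧ A.W p = 0 ∧ A.W q = 0 := by
    simp only [hk, hk', hp, hq, W_algebraMap, and_self]
  obtain ⟨x1, x2, x3, x4⟩ := kill A.dx
  obtain ⟨y1, y2, y3, y4⟩ := kill A.dy
  obtain ⟨v1, v2, v3, v4⟩ := killV
  obtain ⟨w1, w2, w3, w4⟩ := killW
  rw [hc]
  rw [← hk, ← hp] at e₁
  rw [← hk', ← hq] at e₂
  have f1 := congrArg (fun f => A.dx (A.dx f)) e₂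
  have f2 := congrArg A.V e₂
  have f3 := congrArg (fun f => A.dy (A.dy f)) e₁
  have f4 := congrArg A.W e₁
  have c1 := A.V_W_comm ψ
  have d1 : A.dx (A.dx (A.dy (A.dy ψ))) = A.dy (A.dy (A.dx (A.dx ψ))) := by
    simp only [A.dx_dy]
  simp only [map_add, Derivation.leibniz, smul_eq_mul, pow_two, dx_W, map_sub, dx_δ, x2, x4, hx,
    derivation_two, map_zero, mul_zero, add_zero] at f1
  simp only [map_add, Derivation.leibniz, smul_eq_mul, pow_two, dy_V, map_sub, dy_δ, y1, y3, hy,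
    derivation_two, map_zero, mul_zero, add_zero, map_neg] at f3
  simp only [V_add, V_mul, pow_two, V_δ, v2, v4, V_zero, mul_zero, add_zero] at f2
  simp only [W_add, W_mul, pow_two, W_δ, w1, w3, W_zero, mul_zero, add_zero] at f4
  refine (hψ.mul_left_eq_zero).1 ?_
  linear_combination k * f1 + f2 - k' * f3 - f4 + (p * A.δ ^ 2 + h₁) * e₂ -
    (q * A.δ ^ 2 + h₂) * e₁ - 4 * A.δ ^ 2 * (e₂ - e₁) - c1 - k * k' * d1 -
    (4 * A.δ ^ 3 * A.dx ψ + 6 * A.δ ^ 4 * ψ) * hkq + (6 * A.δ ^ 4 * ψ - 4 * A.δ ^ 3 * A.dy ψ) * hkp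

/-- The infinitesimal translation of all points. -/
def trans (f : R) : R := A.dx f + A.dy f + ∑ i, A.dz i f

/-- The infinitesimal dilation of all points. -/
def euler (f : R) : R := A.X * A.dx f + A.Y * A.dy f + ∑ i, A.Z i * A.dz i f

theorem trans_add (f g : R) : A.trans (f + g) = A.trans f + A.trans g := by
  simp only [trans, map_add, Finset.sum_add_distrib]; ring

theorem euler_add (f g : R) : A.euler (f + g) = A.euler f + A.euler g := by
  simp only [euler, map_add, mul_add, Finset.sum_add_distrib]; ring

theorem trans_mul (f g : R) : A.trans (f * g) = f * A.trans g + g * A.trans f := by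
  simp only [trans, Derivation.leibniz, smul_eq_mul, Finset.sum_add_distrib, mul_add,
    Finset.mul_sum]
  ring

theorem euler_mul (f g : R) : A.euler (f * g) = f * A.euler g + g * A.euler f := by
  simp only [euler, Derivation.leibniz, smul_eq_mul, Finset.sum_add_distrib, mul_add,
    Finset.mul_sum, mul_left_comm (A.Z _)]
  ring

theorem trans_algebraMap (r : ℝ) : A.trans (algebraMap ℝ R r) = 0 := by simp [trans]

theorem euler_algebraMap (r : ℝ) : A.euler (algebraMap ℝ R r) = 0 := by simp [euler]

theorem trans_sum {ι : Type*} (s : Finset ι) (f : ι → R) :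
    A.trans (∑ i ∈ s, f i) = ∑ i ∈ s, A.trans (f i) := by
  simp only [trans, map_sum, Finset.sum_add_distrib]
  rw [Finset.sum_comm]

theorem euler_sum {ι : Type*} (s : Finset ι) (f : ι → R) :
    A.euler (∑ i ∈ s, f i) = ∑ i ∈ s, A.euler (f i) := by
  simp only [euler, map_sum, Finset.mul_sum, Finset.sum_add_distrib]
  rw [Finset.sum_comm (s := Finset.univ)]

theorem trans_two : A.trans (2 : R) = 0 := by simp [trans, derivation_two]

theorem euler_two : A.euler (2 : R) = 0 := by simp [euler, derivation_two]

theorem trans_zero : A.trans (0 : R) = 0 := by simp [trans]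

theorem euler_zero : A.euler (0 : R) = 0 := by simp [euler]

theorem trans_δ : A.trans A.δ = 0 := by simp [trans, dx_δ, dy_δ, dz_δ]

theorem euler_δ : A.euler A.δ = -A.δ := by
  simp only [euler, dx_δ, dy_δ, dz_δ, mul_zero, Finset.sum_const_zero]
  linear_combination -A.δ * A.δ_mul

theorem trans_a (i : Fin n) : A.trans (A.a i) = 0 := by simp [trans, dx_a, dy_a, dz_a]

theorem euler_a (i : Fin n) : A.euler (A.a i) = -A.a i := by
  simp only [euler, dx_a, dy_a, dz_a, mul_ite, mul_zero, Finset.sum_ite_eq', Finset.mem_univ,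
    if_true]
  linear_combination -A.a i * A.a_mul i

theorem trans_b (i : Fin n) : A.trans (A.b i) = 0 := by simp [trans, dx_b, dy_b, dz_b]

theorem euler_b (i : Fin n) : A.euler (A.b i) = -A.b i := by
  simp only [euler, dx_b, dy_b, dz_b, mul_ite, mul_zero, Finset.sum_ite_eq', Finset.mem_univ,
    if_true]
  linear_combination -A.b i * A.b_mul i

theorem trans_dx (f : R) : A.trans (A.dx f) = A.dx (A.trans f) := by
  simp only [trans, map_add, map_sum, dx_dy, dx_dz]

theorem trans_dy (f : R) : A.trans (A.dy f) = A.dy (A.trans f) := by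
  simp only [trans, map_add, map_sum, dx_dy, dy_dz]

theorem trans_dz (i : Fin n) (f : R) : A.trans (A.dz i f) = A.dz i (A.trans f) := by
  simp only [trans, map_add, map_sum, dx_dz, dy_dz, A.dz_dz i]

theorem euler_dx (f : R) : A.euler (A.dx f) = A.dx (A.euler f) - A.dx f := by
  simp only [euler, map_add, map_sum, Derivation.leibniz, smul_eq_mul, dx_X, dx_Y, dx_Z, dx_dy,
    dx_dz, mul_zero, add_zero]
  ring

theorem euler_dy (f : R) : A.euler (A.dy f) = A.dy (A.euler f) - A.dy f := by
  simp only [euler, map_add, map_sum, Derivation.leibniz, smul_eq_mul, dy_X, dy_Y, dy_Z, dx_dy,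
    dy_dz, mul_zero, add_zero]
  ring

theorem euler_dz (i : Fin n) (f : R) : A.euler (A.dz i f) = A.dz i (A.euler f) - A.dz i f := by
  simp only [euler, map_add, map_sum, Derivation.leibniz, smul_eq_mul, dz_X, dz_Y, dz_Z, dx_dz,
    dy_dz, A.dz_dz i, mul_zero, add_zero, mul_ite, mul_one, Finset.sum_add_distrib,
    Finset.sum_ite_eq, Finset.mem_univ, if_true]
  ring

theorem trans_V (f : R) : A.trans (A.V f) = A.V (A.trans f) := by
  simp only [V, lx, trans_add, trans_sum, trans_mul, trans_two, trans_a, trans_δ, trans_dz,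
    trans_dy, mul_zero, add_zero]

theorem trans_W (f : R) : A.trans (A.W f) = A.W (A.trans f) := by
  simp only [W, ly, sub_eq_add_neg, ← neg_mul, trans_add, trans_sum, trans_mul, trans_two, trans_b,
    trans_δ, trans_dz, trans_dx, mul_zero, add_zero]
  have : A.trans (-2 : R) = 0 := by simp [trans, derivation_two]
  rw [this]; ring

theorem euler_V (f : R) : A.euler (A.V f) = A.V (A.euler f) - 2 * A.V f := by
  simp only [V, lx, euler_add, euler_sum, euler_mul, euler_two, euler_a, euler_δ, euler_dz,
    euler_dy, mul_zero, add_zero, mul_add, Finset.mul_sum]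
  have : ∑ i, (2 * A.a i * (A.dz i (A.euler f) - A.dz i f) + A.dz i f * (2 * -A.a i)) =
      ∑ i, 2 * A.a i * A.dz i (A.euler f) - ∑ i, 2 * (2 * A.a i * A.dz i f) := by
    rw [← Finset.sum_sub_distrib]
    exact Finset.sum_congr rfl fun i _ => by ring
  rw [this]; ring

theorem euler_W (f : R) : A.euler (A.W f) = A.W (A.euler f) - 2 * A.W f := by
  have h2 : A.euler (-2 : R) = 0 := by simp [euler, derivation_two]
  simp only [W, ly, sub_eq_add_neg, ← neg_mul, euler_add, euler_sum, euler_mul, euler_two, euler_b,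
    euler_δ, euler_dz, euler_dx, mul_zero, add_zero, mul_add, Finset.mul_sum, h2]
  have : ∑ i, (2 * A.b i * A.dz i (A.euler f) + 2 * A.b i * -A.dz i f + A.dz i f * (2 * -A.b i)) =
      ∑ i, 2 * A.b i * A.dz i (A.euler f) - ∑ i, 2 * (2 * A.b i * A.dz i f) := by
    rw [← Finset.sum_sub_distrib]
    exact Finset.sum_congr rfl fun i _ => by ring
  rw [this]; ring

/-- Translation invariance and homogeneity of `ψ` pass to the zero order term of an equation whose
other terms are invariant and homogeneous of degree `-2`. -/
theorem euler_zero_order {k p d : ℝ} {h ψ : R} (hψ : IsUnit ψ) (D : Derivation ℝ R R)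
    (T : R → R) (htD : ∀ f, A.trans (D f) = D (A.trans f))
    (heD : ∀ f, A.euler (D f) = D (A.euler f) - D f)
    (htT : ∀ f, A.trans (T f) = T (A.trans f)) (heT : ∀ f, A.euler (T f) = T (A.euler f) - 2 * T f)
    (hT0 : T 0 = 0) (hTd : T (algebraMap ℝ R d * ψ) = algebraMap ℝ R d * T ψ)
    (e : algebraMap ℝ R k * D (D ψ) + T ψ + (algebraMap ℝ R p * A.δ ^ 2 + h) * ψ = 0)
    (ht : A.trans ψ = 0) (he : A.euler ψ = algebraMap ℝ R d * ψ) :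
    A.trans h = 0 ∧ A.euler h = -2 * h := by
  constructor
  · have f := congrArg A.trans e
    simp only [trans_add, trans_mul, pow_two, trans_algebraMap, trans_δ, htD, htT, ht, hT0,
      map_zero, mul_zero, add_zero, zero_add, trans_zero] at f
    exact hψ.mul_right_eq_zero.1 f
  · have f := congrArg A.euler e
    simp only [euler_add, euler_mul, pow_two, euler_algebraMap, euler_δ, heD, heT, he, hTd,
      mul_zero, add_zero, euler_zero, map_sub, Derivation.leibniz,
      Derivation.map_algebraMap, smul_eq_mul] at f
    rw [← sub_eq_zero]
    refine hψ.mul_right_eq_zero.1 ?_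
    linear_combination f - (algebraMap ℝ R d - 2) * e

/-- Eliminating `∂_x h₁`, `∂_y h₂`, `h₁`, `h₂` from the commutation identity by translation
invariance and homogeneity leaves an identity in the derivatives in the marked points in which the
dependence on `x` and `y` is separated. -/
theorem separated {c : ℝ} {h₁ h₂ : R} (hy : A.dy h₁ = 0) (hx : A.dx h₂ = 0)
    (hE : algebraMap ℝ R c * A.δ ^ 4 + A.V h₂ - A.W h₁ - 4 * A.δ ^ 2 * (h₂ - h₁) = 0)
    (t₁ : A.trans h₁ = 0) (t₂ : A.trans h₂ = 0)
    (s₁ : A.euler h₁ = -2 * h₁) (s₂ : A.euler h₂ = -2 * h₂) :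
    (2 * h₁ = -∑ i, (A.Z i - A.X) * A.dz i h₁) ∧ (2 * h₂ = -∑ i, (A.Z i - A.Y) * A.dz i h₂) ∧
    algebraMap ℝ R c * A.δ ^ 4 + ∑ i, 2 * (A.Z i - A.Y) ^ 2 * A.δ ^ 2 * A.a i * A.dz i h₂ -
      ∑ i, 2 * (A.Z i - A.X) ^ 2 * A.δ ^ 2 * A.b i * A.dz i h₁ = 0 := by
  simp only [trans, euler, hy, hx, mul_zero, add_zero, zero_add] at t₁ t₂ s₁ s₂
  have i₁ : 2 * h₁ = -∑ i, (A.Z i - A.X) * A.dz i h₁ := by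
    simp only [sub_mul, Finset.sum_sub_distrib, ← Finset.mul_sum]
    linear_combination s₁ - A.X * t₁
  have i₂ : 2 * h₂ = -∑ i, (A.Z i - A.Y) * A.dz i h₂ := by
    simp only [sub_mul, Finset.sum_sub_distrib, ← Finset.mul_sum]
    linear_combination s₂ - A.Y * t₂
  refine ⟨i₁, i₂, ?_⟩
  have j₁ : ∑ i, 2 * (A.Z i - A.X) ^ 2 * A.δ ^ 2 * A.b i * A.dz i h₁ = A.ly h₁ +
      2 * A.δ * ∑ i, A.dz i h₁ + 2 * A.δ ^ 2 * ∑ i, (A.Z i - A.X) * A.dz i h₁ := by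
    simp only [ly, Finset.mul_sum, ← Finset.sum_add_distrib]
    refine Finset.sum_congr rfl fun i _ => ?_
    linear_combination A.dz i h₁ * (2 * A.δ ^ 2 * (A.Z i - A.X + A.Y - A.X) * A.b_mul i +
      A.b i * 2 * (A.δ * (A.Y - A.X) + 1) * A.δ_mul + 2 * A.δ * A.δ_mul)
  have j₂ : ∑ i, 2 * (A.Z i - A.Y) ^ 2 * A.δ ^ 2 * A.a i * A.dz i h₂ = A.lx h₂ -
      2 * A.δ * ∑ i, A.dz i h₂ + 2 * A.δ ^ 2 * ∑ i, (A.Z i - A.Y) * A.dz i h₂ := by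
    simp only [lx, Finset.mul_sum, ← Finset.sum_add_distrib, ← Finset.sum_sub_distrib]
    refine Finset.sum_congr rfl fun i _ => ?_
    linear_combination A.dz i h₂ * (2 * A.δ ^ 2 * (A.Z i - A.Y + A.X - A.Y) * A.a_mul i +
      A.a i * 2 * (A.δ * (A.Y - A.X) + 1) * A.δ_mul - 2 * A.δ * A.δ_mul)
  rw [j₁, j₂]
  simp only [V, W] at hE
  linear_combination hE - 2 * A.δ * t₁ - 2 * A.δ * t₂ - 2 * A.δ ^ 2 * (i₁ - i₂)

end ConfigAlgebra

/-! ### The ring of smooth functions on an open set -/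

section Smooth

/-- Extension of a function on `U` by zero. Its values off `U` play no role; it serves to speak of
derivatives of `f`. -/
noncomputable def extendZero {E : Type*} [TopologicalSpace E] {U : Opens E} (f : U → ℝ) : E → ℝ :=
  Function.extend Subtype.val f 0

theorem extendZero_apply {E : Type*} [TopologicalSpace E] {U : Opens E} (f : U → ℝ) (u : U) :
    extendZero f u = f u :=
  Subtype.val_injective.extend_apply f 0 u

theorem extendZero_restrict {E : Type*} [TopologicalSpace E] {U : Opens E} (F : E → ℝ) :
    Set.EqOn (extendZero (fun u : U => F u)) F U := fun w hw =>
  extendZero_apply (fun u : U => F u) ⟨w, hw⟩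

theorem extendZero_eventuallyEq {E : Type*} [TopologicalSpace E] {U : Opens E} (F : E → ℝ) (u : U) :
    extendZero (fun u : U => F u) =ᶠ[𝓝 (u : E)] F :=
  Filter.eventuallyEq_of_mem (U.isOpen.mem_nhds u.2) (extendZero_restrict F)

variable {E : Type*} [NormedAddCommGroup E] [NormedSpace ℝ E]

/-- The algebra of smooth real functions on an open set. -/
def smoothFunctions (U : Opens E) : Subalgebra ℝ (U → ℝ) where
  carrier := {f | ContDiffOn ℝ ∞ (extendZero f) U}
  mul_mem' {f g} hf hg := (ContDiffOn.mul hf hg).congr fun w hw => by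
    simp only [extendZero_apply _ (⟨w, hw⟩ : U), Pi.mul_apply]
  add_mem' {f g} hf hg := (ContDiffOn.add hf hg).congr fun w hw => by
    simp only [extendZero_apply _ (⟨w, hw⟩ : U), Pi.add_apply]
  algebraMap_mem' r := (contDiffOn_const (c := r)).congr fun w hw => by
    simp only [extendZero_apply _ (⟨w, hw⟩ : U)]; rfl

/-- The restriction to `U` of a function smooth on `U`. -/
def restrict {U : Opens E} (F : E → ℝ) (hF : ContDiffOn ℝ ∞ F U) : smoothFunctions U :=
  ⟨fun u => F u, hF.congr (extendZero_restrict F)⟩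

theorem differentiableAt_extendZero {U : Opens E} (f : smoothFunctions U) (u : U) :
    DifferentiableAt ℝ (extendZero f.1) u :=
  ((f.2 : ContDiffOn ℝ ∞ _ _).contDiffAt (U.isOpen.mem_nhds u.2)).differentiableAt (by simp)

/-- The derivative in the direction `v`, as a derivation of the algebra of smooth functions. -/
noncomputable def dirDeriv (U : Opens E) (v : E) :
    Derivation ℝ (smoothFunctions U) (smoothFunctions U) :=
  Derivation.mk'
    { toFun := fun f => restrict (fun w => fderiv ℝ (extendZero f.1) w v)
        (((f.2 : ContDiffOn ℝ ∞ _ _).fderiv_of_isOpen U.isOpen (by simp)).clm_apply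
          contDiffOn_const)
      map_add' := fun f g => by
        ext u
        have : extendZero (f + g : smoothFunctions U).1 =ᶠ[𝓝 (u : E)]
            extendZero f.1 + extendZero g.1 :=
          Filter.eventuallyEq_of_mem (U.isOpen.mem_nhds u.2) fun w hw => by
            simp only [Pi.add_apply, extendZero_apply _ (⟨w, hw⟩ : U)]; rfl
        change fderiv ℝ (extendZero (f + g).1) u v =
          fderiv ℝ (extendZero f.1) u v + fderiv ℝ (extendZero g.1) u v
        rw [this.fderiv_eq, fderiv_add (differentiableAt_extendZero f u)
          (differentiableAt_extendZero g u)]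
        rfl
      map_smul' := fun r f => by
        ext u
        have : extendZero (r • f : smoothFunctions U).1 =ᶠ[𝓝 (u : E)] r • extendZero f.1 :=
          Filter.eventuallyEq_of_mem (U.isOpen.mem_nhds u.2) fun w hw => by
            simp only [Pi.smul_apply, extendZero_apply _ (⟨w, hw⟩ : U)]; rfl
        change fderiv ℝ (extendZero (r • f).1) u v = r * fderiv ℝ (extendZero f.1) u v
        rw [this.fderiv_eq, fderiv_const_smul (differentiableAt_extendZero f u)]
        rfl }
    fun f g => by
      ext u
      have : extendZero (f * g : smoothFunctions U).1 =ᶠ[𝓝 (u : E)]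
          extendZero f.1 * extendZero g.1 :=
        Filter.eventuallyEq_of_mem (U.isOpen.mem_nhds u.2) fun w hw => by
          simp only [Pi.mul_apply, extendZero_apply _ (⟨w, hw⟩ : U)]; rfl
      change fderiv ℝ (extendZero (f * g).1) u v = f.1 u * fderiv ℝ (extendZero g.1) u v +
        g.1 u * fderiv ℝ (extendZero f.1) u v
      rw [this.fderiv_eq, fderiv_mul (differentiableAt_extendZero f u)
        (differentiableAt_extendZero g u), ← extendZero_apply f.1 u, ← extendZero_apply g.1 u]
      rfl

theorem dirDeriv_apply {U : Opens E} (v : E) (f : smoothFunctions U) (u : U) :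
    (dirDeriv U v f).1 u = fderiv ℝ (extendZero f.1) u v := rfl

theorem dirDeriv_restrict {U : Opens E} (v : E) (F : E → ℝ) (hF : ContDiffOn ℝ ∞ F U) (u : U) :
    (dirDeriv U v (restrict F hF)).1 u = fderiv ℝ F u v := by
  rw [dirDeriv_apply]
  exact congrFun (congrArg _ (extendZero_eventuallyEq F u).fderiv_eq) v

theorem dirDeriv_comm {U : Opens E} (v w : E) (f : smoothFunctions U) :
    dirDeriv U v (dirDeriv U w f) = dirDeriv U w (dirDeriv U v f) := by
  ext u
  have hc : ContDiffAt ℝ ∞ (extendZero f.1) u :=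
    (f.2 : ContDiffOn ℝ ∞ _ _).contDiffAt (U.isOpen.mem_nhds u.2)
  have hd : DifferentiableAt ℝ (fderiv ℝ (extendZero f.1)) u :=
    (hc.fderiv_right (m := 1) (by norm_cast)).differentiableAt (by simp)
  have key : ∀ v w : E, (dirDeriv U v (dirDeriv U w f)).1 u =
      fderiv ℝ (fderiv ℝ (extendZero f.1)) u v w := fun v w => by
    change (dirDeriv U v (restrict _ _)).1 u = _
    rw [dirDeriv_restrict, fderiv_clm_apply hd (differentiableAt_const w)]
    simp
  rw [key, key]
  exact (hc.isSymmSndFDerivAt (by simpa using ENat.LEInfty.out)).eq v w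

end Smooth

/-! ### Chambers -/

section

variable {n : ℕ}

theorem pts_zero (w : Config n) : pts w 0 = w.1 := rfl

theorem pts_succ_succ (w : Config n) (i : Fin n) : pts w i.succ.succ = w.2.2 i := rfl

theorem pts_combo (s t : ℝ) (w w' : Config n) (a : Fin (n + 2)) :
    pts (s • w + t • w') a = s * pts w a + t * pts w' a := by
  refine Fin.cases ?_ (fun b => Fin.cases ?_ (fun i => ?_) b) a
  · simp [pts_zero]
  · simp [pts]
  · simp [pts_succ_succ]

theorem continuous_pts (a : Fin (n + 2)) : Continuous fun w : Config n => pts w a := by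
  refine Fin.cases ?_ (fun b => Fin.cases ?_ (fun i => ?_) b) a
  · exact continuous_fst
  · exact continuous_snd.fst
  · exact (continuous_apply i).comp continuous_snd.snd

theorem isOpen_chamber (w₀ : Config n) : IsOpen (chamber w₀) := by
  have : chamber w₀ = ⋂ a, ⋂ b, {w | pts w₀ a < pts w₀ b → pts w a < pts w b} := by
    ext; simp [chamber]
  rw [this]
  refine isOpen_iInter_of_finite fun a => isOpen_iInter_of_finite fun b => ?_
  by_cases h : pts w₀ a < pts w₀ b
  · simpa [h] using isOpen_lt (continuous_pts a) (continuous_pts b)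
  · simp [h]

theorem convex_chamber (w₀ : Config n) : Convex ℝ (chamber w₀) := by
  intro w hw w' hw' s t hs ht hst a b hab
  have h1 := hw a b hab
  have h2 := hw' a b hab
  rw [pts_combo, pts_combo]
  rcases hs.eq_or_lt with rfl | hs
  · have : t = 1 := by linarith
    subst this; linarith
  · have e1 : s * pts w a < s * pts w b := mul_lt_mul_of_pos_left h1 hs
    have e2 : t * pts w' a ≤ t * pts w' b := mul_le_mul_of_nonneg_left h2.le ht
    linarith

theorem injective_pts {w₀ w : Config n} (hw₀ : Function.Injective (pts w₀)) (hw : w ∈ chamber w₀) :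
    Function.Injective (pts w) := by
  intro a b hab
  by_contra hne
  rcases lt_or_gt_of_ne (hw₀.ne hne) with h | h
  · exact (hw a b h).ne hab
  · exact (hw b a h).ne hab.symm

theorem distinct {w₀ : Config n} (hw₀ : Function.Injective (pts w₀)) {x y : ℝ} {z : Fin n → ℝ}
    (hw : (x, y, z) ∈ chamber w₀) :
    y ≠ x ∧ (∀ i, z i ≠ x) ∧ (∀ i, z i ≠ y) ∧ Function.Injective z := by
  have h := injective_pts hw₀ hw
  refine ⟨fun e => ?_, fun i e => ?_, fun i e => ?_, fun i j e => ?_⟩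
  · have := @h 1 0 e
    simp at this
  · have := @h i.succ.succ 0 e
    exact Fin.succ_ne_zero _ this
  · have := @h i.succ.succ 1 e
    exact Fin.succ_ne_zero _ (Fin.succ_injective _ this)
  · exact Fin.succ_injective _ (Fin.succ_injective _ (@h i.succ.succ j.succ.succ e))

/-! ### Smooth functions on a chamber -/

/-- The chamber as an open set. -/
def chamberOpens (w₀ : Config n) : Opens (Config n) := ⟨chamber w₀, isOpen_chamber w₀⟩

/-- The coordinate vector of `x`. -/
def ex (n : ℕ) : Config n := (1, 0, 0)

/-- The coordinate vector of `y`. -/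
def ey (n : ℕ) : Config n := (0, 1, 0)

/-- The coordinate vector of `z i`. -/
noncomputable def ez (i : Fin n) : Config n := (0, 0, Pi.single i 1)

/-- The coordinate `x` as a linear form. -/
def coordX (n : ℕ) : Config n →L[ℝ] ℝ := ContinuousLinearMap.fst ℝ _ _

/-- The coordinate `y` as a linear form. -/
def coordY (n : ℕ) : Config n →L[ℝ] ℝ :=
  (ContinuousLinearMap.fst ℝ _ _).comp (ContinuousLinearMap.snd ℝ _ _)

/-- The coordinate `z i` as a linear form. -/
def coordZ (i : Fin n) : Config n →L[ℝ] ℝ :=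
  (ContinuousLinearMap.proj i).comp
    ((ContinuousLinearMap.snd ℝ ℝ (Fin n → ℝ)).comp (ContinuousLinearMap.snd ℝ _ _))

theorem clm_decomp (L : Config n →L[ℝ] ℝ) (a b : ℝ) (c : Fin n → ℝ) :
    L (a, b, c) = a * L (ex n) + b * L (ey n) + ∑ i, c i * L (ez i) := by
  have : ((a, b, c) : Config n) = a • ex n + b • ey n + ∑ i, c i • ez i := by
    have h3 : (∑ i, c i • ez i : Config n) = (0, 0, c) := by
      refine Prod.ext ?_ (Prod.ext ?_ ?_)
      · simp [Prod.fst_sum, ez]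
      · simp [Prod.fst_sum, Prod.snd_sum, ez]
      · funext j
        simp [Prod.snd_sum, ez, Finset.sum_apply, Pi.single_apply]
    rw [h3]
    simp [ex, ey]
  rw [this]
  simp only [map_add, map_smul, map_sum, smul_eq_mul]

theorem dirDeriv_clm {E : Type*} [NormedAddCommGroup E] [NormedSpace ℝ E] {U : Opens E} (v : E)
    (L : E →L[ℝ] ℝ) :
    dirDeriv U v (restrict L L.contDiff.contDiffOn) = algebraMap ℝ _ (L v) := by
  ext u
  rw [dirDeriv_restrict, L.fderiv]
  rfl

/-- The inverse of a smooth function without zeros. -/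
noncomputable def invOn {E : Type*} [NormedAddCommGroup E] [NormedSpace ℝ E] {U : Opens E}
    (F : E → ℝ) (hF : ContDiffOn ℝ ∞ F U) (h : ∀ w ∈ U, F w ≠ 0) : smoothFunctions U :=
  restrict (fun w => (F w)⁻¹) (hF.inv h)

theorem invOn_mul {E : Type*} [NormedAddCommGroup E] [NormedSpace ℝ E] {U : Opens E}
    (F : E → ℝ) (hF : ContDiffOn ℝ ∞ F U) (h : ∀ w ∈ U, F w ≠ 0) :
    invOn F hF h * restrict F hF = 1 := by
  ext u
  exact inv_mul_cancel₀ (h u u.2)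

/-- The smooth functions on a chamber form a `ConfigAlgebra`. -/
noncomputable def chamberAlgebra (w₀ : Config n) (hw₀ : Function.Injective (pts w₀)) :
    ConfigAlgebra n (smoothFunctions (chamberOpens w₀)) where
  dx := dirDeriv _ (ex n)
  dy := dirDeriv _ (ey n)
  dz i := dirDeriv _ (ez i)
  dx_dy := dirDeriv_comm _ _
  dx_dz _ := dirDeriv_comm _ _
  dy_dz _ := dirDeriv_comm _ _
  dz_dz _ _ := dirDeriv_comm _ _
  X := restrict (coordX n) (coordX n).contDiff.contDiffOn
  Y := restrict (coordY n) (coordY n).contDiff.contDiffOn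
  Z i := restrict (coordZ i) (coordZ i).contDiff.contDiffOn
  dx_X := by rw [dirDeriv_clm]; simp [coordX, ex]
  dx_Y := by rw [dirDeriv_clm]; simp [coordY, ex]
  dx_Z i := by rw [dirDeriv_clm]; simp [coordZ, ex]
  dy_X := by rw [dirDeriv_clm]; simp [coordX, ey]
  dy_Y := by rw [dirDeriv_clm]; simp [coordY, ey]
  dy_Z i := by rw [dirDeriv_clm]; simp [coordZ, ey]
  dz_X i := by rw [dirDeriv_clm]; simp [coordX, ez]
  dz_Y i := by rw [dirDeriv_clm]; simp [coordY, ez]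
  dz_Z i j := by
    rw [dirDeriv_clm]
    by_cases h : i = j
    · subst h; simp [coordZ, ez]
    · simp [coordZ, ez, h, Ne.symm h]
  δ := invOn (fun w => w.2.1 - w.1) ((coordY n) - (coordX n)).contDiff.contDiffOn
    fun w hw => sub_ne_zero.2 (distinct hw₀ hw).1
  a i := invOn (fun w => w.2.2 i - w.1) ((coordZ i) - (coordX n)).contDiff.contDiffOn
    fun w hw => sub_ne_zero.2 ((distinct hw₀ hw).2.1 i)
  b i := invOn (fun w => w.2.2 i - w.2.1) ((coordZ i) - (coordY n)).contDiff.contDiffOn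
    fun w hw => sub_ne_zero.2 ((distinct hw₀ hw).2.2.1 i)
  δ_mul := invOn_mul _ ((coordY n) - (coordX n)).contDiff.contDiffOn _
  a_mul i := invOn_mul _ ((coordZ i) - (coordX n)).contDiff.contDiffOn _
  b_mul i := invOn_mul _ ((coordZ i) - (coordY n)).contDiff.contDiffOn _

/-! ### Derivatives along the coordinate lines -/

theorem hasDerivAt_lineX (x y : ℝ) (z : Fin n → ℝ) :
    HasDerivAt (fun t : ℝ => ((t, y, z) : Config n)) (ex n) x :=
  (hasDerivAt_id x).prodMk (hasDerivAt_const x (y, z))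

theorem hasDerivAt_lineY (x y : ℝ) (z : Fin n → ℝ) :
    HasDerivAt (fun t : ℝ => ((x, t, z) : Config n)) (ey n) y :=
  (hasDerivAt_const y x).prodMk ((hasDerivAt_id y).prodMk (hasDerivAt_const y z))

theorem hasDerivAt_lineZ (x y : ℝ) (z : Fin n → ℝ) (i : Fin n) :
    HasDerivAt (fun t : ℝ => ((x, y, Function.update z i t) : Config n)) (ez i) (z i) :=
  (hasDerivAt_const _ x).prodMk ((hasDerivAt_const _ y).prodMk (hasDerivAt_update z i (z i)))

/-- The derivative of `F` along a curve that stays in the open set `U`, in terms of a function `f`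
that agrees with `F` along the curve. -/
theorem dirDeriv_eq_deriv {E : Type*} [NormedAddCommGroup E] [NormedSpace ℝ E] {U : Opens E}
    (F : smoothFunctions U) {c : ℝ → E} {v : E} {t : ℝ} (hc : HasDerivAt c v t) (ht : c t ∈ U)
    {f : ℝ → ℝ} (hf : ∀ s (hs : c s ∈ U), F.1 ⟨c s, hs⟩ = f s) :
    (dirDeriv U v F).1 ⟨c t, ht⟩ = deriv f t := by
  have h1 : HasDerivAt (extendZero F.1 ∘ c) (fderiv ℝ (extendZero F.1) (c t) v) t :=
    (differentiableAt_extendZero F ⟨c t, ht⟩).hasFDerivAt.comp_hasDerivAt t hc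
  have h2 : extendZero F.1 ∘ c =ᶠ[𝓝 t] f := by
    filter_upwards [hc.continuousAt.preimage_mem_nhds (U.isOpen.mem_nhds ht)] with s hs
    rw [Function.comp_apply, extendZero_apply F.1 (⟨c s, hs⟩ : U), hf s hs]
  rw [dirDeriv_apply, ← h2.deriv_eq, h1.deriv]

end

/-! ### The separated identity at a configuration -/

section

/-- Evaluation of smooth functions at a point. -/
def evalAt {E : Type*} [NormedAddCommGroup E] [NormedSpace ℝ E] {U : Opens E} (u : U) :
    smoothFunctions U →ₐ[ℝ] ℝ := (Pi.evalAlgHom ℝ (fun _ : U => ℝ) u).comp (smoothFunctions U).val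

theorem evalAt_algebraMap {E : Type*} [NormedAddCommGroup E] [NormedSpace ℝ E] {U : Opens E}
    (u : U) (r : ℝ) : evalAt u (algebraMap ℝ _ r) = r := (evalAt u).commutes r

section Evaluation

variable {n : ℕ} {w₀ : Config n} (hw₀ : Function.Injective (pts w₀)) {x y : ℝ} {z : Fin n → ℝ}
  (hw : (x, y, z) ∈ chamberOpens w₀)

theorem evalAt_dx {F : smoothFunctions (chamberOpens w₀)} {f : ℝ → ℝ}
    (hf : ∀ t (ht : (t, y, z) ∈ chamberOpens w₀), evalAt ⟨(t, y, z), ht⟩ F = f t) :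
    evalAt ⟨(x, y, z), hw⟩ ((chamberAlgebra w₀ hw₀).dx F) = deriv f x :=
  dirDeriv_eq_deriv F (hasDerivAt_lineX x y z) hw hf

theorem evalAt_dy {F : smoothFunctions (chamberOpens w₀)} {f : ℝ → ℝ}
    (hf : ∀ t (ht : (x, t, z) ∈ chamberOpens w₀), evalAt ⟨(x, t, z), ht⟩ F = f t) :
    evalAt ⟨(x, y, z), hw⟩ ((chamberAlgebra w₀ hw₀).dy F) = deriv f y :=
  dirDeriv_eq_deriv F (hasDerivAt_lineY x y z) hw hf

theorem evalAt_dz {F : smoothFunctions (chamberOpens w₀)} {g : (Fin n → ℝ) → ℝ} (i : Fin n)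
    (hg : ∀ z (hz : (x, y, z) ∈ chamberOpens w₀), evalAt ⟨(x, y, z), hz⟩ F = g z) :
    evalAt ⟨(x, y, z), hw⟩ ((chamberAlgebra w₀ hw₀).dz i F) = pderiv i g z := by
  have hz : (x, y, Function.update z i (z i)) ∈ chamberOpens w₀ := by
    rwa [Function.update_eq_self]
  have := dirDeriv_eq_deriv F (hasDerivAt_lineZ x y z i) hz
    (f := fun t => g (Function.update z i t)) fun s hs => hg _ hs
  rw [pderiv, ← this]
  simp only [Function.update_eq_self]
  rfl

theorem evalAt_X : evalAt ⟨(x, y, z), hw⟩ (chamberAlgebra w₀ hw₀).X = x := rfl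

theorem evalAt_Y : evalAt ⟨(x, y, z), hw⟩ (chamberAlgebra w₀ hw₀).Y = y := rfl

theorem evalAt_Z (i : Fin n) : evalAt ⟨(x, y, z), hw⟩ ((chamberAlgebra w₀ hw₀).Z i) = z i := rfl

theorem evalAt_δ : evalAt ⟨(x, y, z), hw⟩ (chamberAlgebra w₀ hw₀).δ = (y - x)⁻¹ := rfl

theorem evalAt_a (i : Fin n) :
    evalAt ⟨(x, y, z), hw⟩ ((chamberAlgebra w₀ hw₀).a i) = (z i - x)⁻¹ := rfl

theorem evalAt_b (i : Fin n) :
    evalAt ⟨(x, y, z), hw⟩ ((chamberAlgebra w₀ hw₀).b i) = (z i - y)⁻¹ := rfl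

theorem contDiffAt_of_evalAt {x y : ℝ} {z : Fin n → ℝ} (hw : (x, y, z) ∈ chamberOpens w₀)
    {F : smoothFunctions (chamberOpens w₀)} {g : (Fin n → ℝ) → ℝ}
    (hg : ∀ z (hz : (x, y, z) ∈ chamberOpens w₀), evalAt ⟨(x, y, z), hz⟩ F = g z) :
    ContDiffAt ℝ ∞ g z := by
  have hline : ContDiff ℝ ∞ fun u : Fin n → ℝ => ((x, y, u) : Config n) :=
    contDiff_const.prodMk (contDiff_const.prodMk contDiff_id)
  have h1 : ContDiffAt ℝ ∞ (extendZero F.1 ∘ fun u : Fin n → ℝ => ((x, y, u) : Config n)) z :=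
    ContDiffAt.comp z (((F.2 : ContDiffOn ℝ ∞ _ _)).contDiffAt
      ((chamberOpens w₀).isOpen.mem_nhds hw)) hline.contDiffAt
  refine h1.congr_of_eventuallyEq ?_
  filter_upwards [hline.continuous.continuousAt.preimage_mem_nhds
    ((chamberOpens w₀).isOpen.mem_nhds hw)] with u hu
  rw [Function.comp_apply, extendZero_apply F.1 (⟨(x, y, u), hu⟩ : chamberOpens w₀), ← hg u hu]
  rfl

end Evaluation

variable {n : ℕ} {κ κ' : ℝ} {w₀ : Config n} {h₁ h₂ : ℝ → (Fin n → ℝ) → ℝ} {ψ : Config n → ℝ}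

/-- `ConfigAlgebra.separated` at a configuration, in terms of the functions `h₁` and `h₂`. Their
smoothness comes from the equations, solved for them. -/
theorem separated_pointwise (hκ : 0 < κ) (hκ' : 0 < κ') (hw₀ : Function.Injective (pts w₀))
    (hsmooth : ContDiffOn ℝ ∞ ψ (chamber w₀)) (hne : ∀ w ∈ chamber w₀, ψ w ≠ 0)
    (htrans : ∀ (c x y : ℝ) (z : Fin n → ℝ), (x, y, z) ∈ chamber w₀ →
      ψ (x + c, y + c, fun i => z i + c) = ψ (x, y, z)) (d : ℝ)
    (hhom : ∀ (r x y : ℝ) (z : Fin n → ℝ), 0 < r → (x, y, z) ∈ chamber w₀ →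
      ψ (r * x, r * y, fun i => r * z i) = r ^ d * ψ (x, y, z))
    (hsol : IsSolution κ κ' h₁ h₂ (chamber w₀) ψ) {x y : ℝ} {z : Fin n → ℝ}
    (hw : (x, y, z) ∈ chamber w₀) :
    ContDiffAt ℝ ∞ (h₁ x) z ∧ ContDiffAt ℝ ∞ (h₂ y) z ∧
    2 * h₁ x z = -∑ i, (z i - x) * pderiv i (h₁ x) z ∧
    2 * h₂ y z = -∑ i, (z i - y) * pderiv i (h₂ y) z ∧
    ∑ i, (z i - y) ^ 2 * pderiv i (h₂ y) z / (z i - x) -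
      ∑ i, (z i - x) ^ 2 * pderiv i (h₁ x) z / (z i - y) =
        -(3 * (κ - κ') + 48 * (1 / κ - 1 / κ')) / 2 / (x - y) ^ 2 := by
  set A := chamberAlgebra w₀ hw₀ with hA
  set Ψ : smoothFunctions (chamberOpens w₀) := restrict ψ hsmooth with hΨ
  have hinv : invOn ψ hsmooth hne * Ψ = 1 := invOn_mul ψ hsmooth hne
  have hu : IsUnit Ψ := IsUnit.of_mul_eq_one _ ((mul_comm _ _).trans hinv)
  have evΨ : ∀ w (hw : w ∈ chamberOpens w₀), evalAt ⟨w, hw⟩ Ψ = ψ w := fun _ _ => rfl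
  -- The zero order terms, as elements of the algebra, are determined by the equations.
  obtain ⟨H₁, e₁⟩ : ∃ H, algebraMap ℝ _ (κ / 2) * A.dx (A.dx Ψ) + A.V Ψ +
      (algebraMap ℝ _ (1 - 6 / κ') * A.δ ^ 2 + H) * Ψ = 0 :=
    ⟨-(algebraMap ℝ _ (κ / 2) * A.dx (A.dx Ψ) + A.V Ψ) * invOn ψ hsmooth hne -
      algebraMap ℝ _ (1 - 6 / κ') * A.δ ^ 2, by
        linear_combination -(algebraMap ℝ _ (κ / 2) * A.dx (A.dx Ψ) + A.V Ψ) * hinv⟩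
  obtain ⟨H₂, e₂⟩ : ∃ H, algebraMap ℝ _ (κ' / 2) * A.dy (A.dy Ψ) + A.W Ψ +
      (algebraMap ℝ _ (1 - 6 / κ) * A.δ ^ 2 + H) * Ψ = 0 :=
    ⟨-(algebraMap ℝ _ (κ' / 2) * A.dy (A.dy Ψ) + A.W Ψ) * invOn ψ hsmooth hne -
      algebraMap ℝ _ (1 - 6 / κ) * A.δ ^ 2, by
        linear_combination -(algebraMap ℝ _ (κ' / 2) * A.dy (A.dy Ψ) + A.W Ψ) * hinv⟩
  have hdx : ∀ {x y z} (hw : (x, y, z) ∈ chamberOpens w₀), evalAt ⟨(x, y, z), hw⟩ (A.dx Ψ) =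
      deriv (fun t => ψ (t, y, z)) x := fun hw => evalAt_dx hw₀ hw fun t ht => evΨ _ ht
  have hdy : ∀ {x y z} (hw : (x, y, z) ∈ chamberOpens w₀), evalAt ⟨(x, y, z), hw⟩ (A.dy Ψ) =
      deriv (fun t => ψ (x, t, z)) y := fun hw => evalAt_dy hw₀ hw fun t ht => evΨ _ ht
  have hdz : ∀ {x y z} (hw : (x, y, z) ∈ chamberOpens w₀) (i : Fin n),
      evalAt ⟨(x, y, z), hw⟩ (A.dz i Ψ) = pderiv i (fun u => ψ (x, y, u)) z :=
    fun hw i => evalAt_dz hw₀ hw i fun t ht => evΨ _ ht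
  have ev₁ : ∀ x y z (hw : (x, y, z) ∈ chamberOpens w₀), evalAt ⟨(x, y, z), hw⟩ H₁ = h₁ x z := by
    intro x y z hw
    have f := congrArg (evalAt ⟨(x, y, z), hw⟩) e₁
    have g := (hsol x y z hw).1
    simp only [map_add, map_mul, map_pow, evalAt_algebraMap, ConfigAlgebra.V, ConfigAlgebra.lx,
      map_sum, map_ofNat, map_zero] at f
    rw [hA, evalAt_dx hw₀ hw fun t ht => hdx ht] at f
    simp only [← hA, hdy, hdz] at f
    simp only [hA, evalAt_δ, evalAt_a, evΨ] at f
    rw [iteratedDeriv_succ, iteratedDeriv_one] at g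
    simp only [ell, markedFlow] at g
    refine mul_right_cancel₀ (hne _ hw) ?_
    simp only [div_eq_mul_inv, one_mul, inv_pow] at f g ⊢
    linear_combination f - g
  have ev₂ : ∀ x y z (hw : (x, y, z) ∈ chamberOpens w₀), evalAt ⟨(x, y, z), hw⟩ H₂ = h₂ y z := by
    intro x y z hw
    have f := congrArg (evalAt ⟨(x, y, z), hw⟩) e₂
    have g := (hsol x y z hw).2
    simp only [map_add, map_sub, map_mul, map_pow, evalAt_algebraMap, ConfigAlgebra.W,
      ConfigAlgebra.ly, map_sum, map_ofNat, map_zero] at f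
    rw [hA, evalAt_dy hw₀ hw fun t ht => hdy ht] at f
    simp only [← hA, hdx, hdz] at f
    simp only [hA, evalAt_δ, evalAt_b, evΨ] at f
    rw [iteratedDeriv_succ, iteratedDeriv_one] at g
    simp only [ell, markedFlow] at g
    refine mul_right_cancel₀ (hne _ hw) ?_
    have hs : (x - y)⁻¹ = -(y - x)⁻¹ := by rw [← neg_sub y x, inv_neg]
    simp only [div_eq_mul_inv, one_mul, hs, ← inv_pow, neg_sq] at f g ⊢
    linear_combination f - g
  have hy : A.dy H₁ = 0 := by
    ext ⟨⟨x, y, z⟩, hw⟩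
    refine (evalAt_dy hw₀ hw (f := fun _ => h₁ x z) fun t ht => ev₁ _ _ _ ht).trans ?_
    exact deriv_const _ _
  have hx : A.dx H₂ = 0 := by
    ext ⟨⟨x, y, z⟩, hw⟩
    refine (evalAt_dx hw₀ hw (f := fun _ => h₂ y z) fun t ht => ev₂ _ _ _ ht).trans ?_
    exact deriv_const _ _
  have hval : ∀ {x y : ℝ} {z : Fin n → ℝ} (hw : (x, y, z) ∈ chamberOpens w₀) (a b : ℝ)
      (c : Fin n → ℝ), fderiv ℝ ψ (x, y, z) (a, b, c) = a * evalAt ⟨(x, y, z), hw⟩ (A.dx Ψ) +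
        b * evalAt ⟨(x, y, z), hw⟩ (A.dy Ψ) + ∑ i, c i * evalAt ⟨(x, y, z), hw⟩ (A.dz i Ψ) := by
    intro x y z hw a b c
    rw [clm_decomp]
    have := fun v => dirDeriv_restrict (U := chamberOpens w₀) v ψ hsmooth ⟨(x, y, z), hw⟩
    simp only [← this]
    rfl
  have hdiff : ∀ {w}, w ∈ chamber w₀ → HasFDerivAt ψ (fderiv ℝ ψ w) w := fun hw =>
    ((hsmooth.contDiffAt ((isOpen_chamber w₀).mem_nhds hw)).differentiableAt
      (by simp)).hasFDerivAt
  have ht : A.trans Ψ = 0 := by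
    ext ⟨⟨x, y, z⟩, hw⟩
    change evalAt ⟨(x, y, z), hw⟩ (A.trans Ψ) = 0
    have hc : HasDerivAt (fun c : ℝ => ((x + c, y + c, fun i => z i + c) : Config n))
        (1, 1, fun _ => 1) 0 :=
      ((hasDerivAt_id _).const_add x).prodMk (((hasDerivAt_id _).const_add y).prodMk
        (hasDerivAt_pi.2 fun i => (hasDerivAt_id _).const_add (z i)))
    have h1 := HasFDerivAt.comp_hasDerivAt (0 : ℝ) (f := fun c : ℝ =>
      ((x + c, y + c, fun i => z i + c) : Config n)) (by simpa using hdiff hw) hc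
    have h2 : HasDerivAt (fun c : ℝ => ψ (x + c, y + c, fun i => z i + c)) 0 0 := by
      simp only [fun c => htrans c x y z hw]
      exact hasDerivAt_const _ _
    have h3 := h1.unique h2
    rw [hval hw] at h3
    simpa [ConfigAlgebra.trans] using h3
  have he : A.euler Ψ = algebraMap ℝ _ d * Ψ := by
    ext ⟨⟨x, y, z⟩, hw⟩
    change evalAt ⟨(x, y, z), hw⟩ (A.euler Ψ) = evalAt ⟨(x, y, z), hw⟩ (algebraMap ℝ _ d * Ψ)
    have hc : HasDerivAt (fun c : ℝ => ((c * x, c * y, fun i => c * z i) : Config n))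
        (x, y, z) 1 := by
      have := fun t : ℝ => (hasDerivAt_id (1 : ℝ)).mul_const t
      simp only [one_mul, id] at this
      exact (this x).prodMk ((this y).prodMk (hasDerivAt_pi.2 fun i => this (z i)))
    have h1 := HasFDerivAt.comp_hasDerivAt (1 : ℝ) (f := fun c : ℝ =>
      ((c * x, c * y, fun i => c * z i) : Config n)) (by simpa using hdiff hw) hc
    have h2 : HasDerivAt (fun c : ℝ => ψ (c * x, c * y, fun i => c * z i))
        (d * ψ (x, y, z)) 1 := by
      have : HasDerivAt (fun c : ℝ => c ^ d * ψ (x, y, z)) (d * ψ (x, y, z)) 1 := by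
        simpa using (Real.hasDerivAt_rpow_const (p := d) (Or.inl one_ne_zero)).mul_const
          (ψ (x, y, z))
      refine this.congr_of_eventuallyEq ?_
      filter_upwards [lt_mem_nhds one_pos] with r hr
      exact hhom r x y z hr hw
    have h3 := h1.unique h2
    rw [hval hw] at h3
    simp only [ConfigAlgebra.euler, map_add, map_mul, map_sum, evalAt_algebraMap, evΨ]
    exact h3
  obtain ⟨t₁, s₁⟩ := A.euler_zero_order hu A.dx A.V A.trans_dx A.euler_dx A.trans_V A.euler_V
    A.V_zero (by rw [A.V_mul, A.V_algebraMap]; ring) e₁ ht he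
  obtain ⟨t₂, s₂⟩ := A.euler_zero_order hu A.dy A.W A.trans_dy A.euler_dy A.trans_W A.euler_W
    A.W_zero (by rw [A.W_mul, A.W_algebraMap]; ring) e₂ ht he
  obtain ⟨i₁, i₂, i₃⟩ := A.separated hy hx
    (A.commutation hκ.ne' hκ'.ne' hu hy hx e₁ e₂) t₁ t₂ s₁ s₂
  have hw' : (x, y, z) ∈ chamberOpens w₀ := hw
  have dz₁ := fun i => evalAt_dz hw₀ hw' i fun u hu => ev₁ x y u hu
  have dz₂ := fun i => evalAt_dz hw₀ hw' i fun u hu => ev₂ x y u hu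
  refine ⟨contDiffAt_of_evalAt hw' fun u hu => ev₁ x y u hu,
    contDiffAt_of_evalAt hw' fun u hu => ev₂ x y u hu, ?_, ?_, ?_⟩
  · have := congrArg (evalAt ⟨(x, y, z), hw'⟩) i₁
    simpa only [map_mul, map_ofNat, map_neg, map_sum, map_sub, hA, evalAt_Z, evalAt_X, dz₁, ev₁]
      using this
  · have := congrArg (evalAt ⟨(x, y, z), hw'⟩) i₂
    simpa only [map_mul, map_ofNat, map_neg, map_sum, map_sub, hA, evalAt_Z, evalAt_Y, dz₂, ev₂]
      using this
  · have f := congrArg (evalAt ⟨(x, y, z), hw'⟩) i₃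
    simp only [map_mul, map_ofNat, map_sum, map_sub, map_add, map_pow, map_zero, hA, evalAt_Z,
      evalAt_Y, evalAt_X, evalAt_δ, evalAt_a, evalAt_b, dz₂, dz₁, evalAt_algebraMap] at f
    have hyx : y - x ≠ 0 := sub_ne_zero.2 (distinct hw₀ hw).1
    have q₁ : ∑ i, 2 * (z i - y) ^ 2 * (y - x)⁻¹ ^ 2 * (z i - x)⁻¹ * pderiv i (h₂ y) z =
        2 * (y - x)⁻¹ ^ 2 * ∑ i, (z i - y) ^ 2 * pderiv i (h₂ y) z / (z i - x) := by
      rw [Finset.mul_sum]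
      exact Finset.sum_congr rfl fun i _ => by ring
    have q₂ : ∑ i, 2 * (z i - x) ^ 2 * (y - x)⁻¹ ^ 2 * (z i - y)⁻¹ * pderiv i (h₁ x) z =
        2 * (y - x)⁻¹ ^ 2 * ∑ i, (z i - x) ^ 2 * pderiv i (h₁ x) z / (z i - y) := by
      rw [Finset.mul_sum]
      exact Finset.sum_congr rfl fun i _ => by ring
    rw [q₁, q₂] at f
    rw [← neg_sub y x, neg_sq, eq_div_iff (pow_ne_zero 2 hyx)]
    generalize 3 * (κ - κ') + 48 * (1 / κ - 1 / κ') = c at f ⊢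
    field_simp at f
    linear_combination f / 2

end

/-! ### The pole matrix of the zero order terms -/

section

variable {n : ℕ}

theorem mem_markedChamber {w₀ : Config n} {x y : ℝ} {z : Fin n → ℝ}
    (hw : (x, y, z) ∈ chamber w₀) : z ∈ markedChamber w₀.2.2 :=
  fun i j hij => hw i.succ.succ j.succ.succ hij

theorem self_mem_chamber (w₀ : Config n) : w₀ ∈ chamber w₀ := fun _ _ h => h

theorem isOpen_markedChamber (z₀ : Fin n → ℝ) : IsOpen (markedChamber z₀) := by
  have : markedChamber z₀ = ⋂ a, ⋂ b, {w | z₀ a < z₀ b → w a < w b} := by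
    ext; simp [markedChamber]
  rw [this]
  refine isOpen_iInter_of_finite fun a => isOpen_iInter_of_finite fun b => ?_
  by_cases h : z₀ a < z₀ b
  · simpa [h] using isOpen_lt (continuous_apply a) (continuous_apply b)
  · simp [h]

theorem convex_markedChamber (z₀ : Fin n → ℝ) : Convex ℝ (markedChamber z₀) := by
  intro w hw w' hw' s t hs ht hst a b hab
  have h1 := hw a b hab
  have h2 := hw' a b hab
  simp only [Pi.add_apply, Pi.smul_apply, smul_eq_mul]
  rcases hs.eq_or_lt with rfl | hs
  · have : t = 1 := by linarith
    subst this; linarith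
  · have e1 : s * w a < s * w b := mul_lt_mul_of_pos_left h1 hs
    have e2 : t * w' a ≤ t * w' b := mul_le_mul_of_nonneg_left h2.le ht
    linarith

theorem injective_of_mem_markedChamber {z₀ z : Fin n → ℝ} (h₀ : Function.Injective z₀)
    (hz : z ∈ markedChamber z₀) : Function.Injective z := by
  intro a b hab
  by_contra hne
  rcases lt_or_gt_of_ne (h₀.ne hne) with h | h
  · exact (hz a b h).ne hab
  · exact (hz b a h).ne hab.symm

theorem injective_marked {w₀ : Config n} (hw₀ : Function.Injective (pts w₀)) :
    Function.Injective w₀.2.2 := (distinct hw₀ (self_mem_chamber w₀)).2.2.2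

/-- One more point can be inserted into a list of points in the same relative position. -/
theorem exists_same_position {ι : Type*} [Fintype ι] (p q : ι → ℝ)
    (h : ∀ i j, p i < p j → q i < q j) (x : ℝ) :
    ∃ x', (∀ i, p i < x → q i < x') ∧ ∀ i, x < p i → x' < q i := by
  classical
  obtain ⟨m, h1, h2⟩ := Order.exists_between_finsets
    ((Finset.univ.filter fun i => p i < x).image q) ((Finset.univ.filter fun i => x < p i).image q)
    (by
      intro a ha b hb
      obtain ⟨i, hi, rfl⟩ := Finset.mem_image.1 ha
      obtain ⟨j, hj, rfl⟩ := Finset.mem_image.1 hb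
      exact h i j ((Finset.mem_filter.1 hi).2.trans (Finset.mem_filter.1 hj).2))
  exact ⟨m, fun i hi => h1 _ (Finset.mem_image_of_mem _ (by simpa using hi)),
    fun i hi => h2 _ (Finset.mem_image_of_mem _ (by simpa using hi))⟩

/-- The chamber projects onto the marked chamber. -/
theorem exists_mem_chamber {w₀ : Config n} {z : Fin n → ℝ} (hz : z ∈ markedChamber w₀.2.2) :
    ∃ x y, (x, y, z) ∈ chamber w₀ := by
  obtain ⟨y, y1, y2⟩ := exists_same_position w₀.2.2 z hz w₀.2.1
  have hy : ∀ i j : Fin (n + 1), Matrix.vecCons w₀.2.1 w₀.2.2 i < Matrix.vecCons w₀.2.1 w₀.2.2 j →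
      Matrix.vecCons y z i < Matrix.vecCons y z j := by
    intro i j
    refine Fin.cases ?_ (fun i => ?_) i <;> refine Fin.cases ?_ (fun j => ?_) j
    · simp
    · simpa using y2 j
    · simpa using y1 i
    · simpa using hz i j
  obtain ⟨x, x1, x2⟩ := exists_same_position _ _ hy w₀.1
  refine ⟨x, y, fun i j => ?_⟩
  refine Fin.cases ?_ (fun i => ?_) i <;> refine Fin.cases ?_ (fun j => ?_) j
  · simp [pts]
  · simpa [pts] using x2 j
  · simpa [pts] using x1 i
  · simpa [pts] using hy i j

theorem exists_box {w₀ : Config n} {x y : ℝ} {z : Fin n → ℝ} (hw : (x, y, z) ∈ chamber w₀) :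
    ∃ I ∈ 𝓝 x, ∃ J ∈ 𝓝 y, ∃ V ∈ 𝓝 z, ∀ x' ∈ I, ∀ y' ∈ J, ∀ z' ∈ V, (x', y', z') ∈ chamber w₀ := by
  obtain ⟨I, hI, s, hs, h⟩ := mem_nhds_prod_iff.1 ((isOpen_chamber w₀).mem_nhds hw)
  obtain ⟨J, hJ, V, hV, h'⟩ := mem_nhds_prod_iff.1 hs
  exact ⟨I, hI, J, hJ, V, hV, fun x' hx' y' hy' z' hz' => h ⟨hx', h' ⟨hy', hz'⟩⟩⟩

/-- The entries of the inverse of a matrix depending smoothly on a parameter are smooth. -/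
theorem contDiffAt_matrix_inv {E ι : Type*} [NormedAddCommGroup E] [NormedSpace ℝ E] [Fintype ι]
    [DecidableEq ι] {M : E → Matrix ι ι ℝ} {e : E} (hM : ∀ i j, ContDiffAt ℝ ∞ (fun e => M e i j) e)
    (hdet : (M e).det ≠ 0) (i j : ι) : ContDiffAt ℝ ∞ (fun e => (M e)⁻¹ i j) e := by
  have det : ∀ {N : E → Matrix ι ι ℝ}, (∀ i j, ContDiffAt ℝ ∞ (fun e => N e i j) e) →
      ContDiffAt ℝ ∞ (fun e => (N e).det) e := by
    intro N hN
    simp only [Matrix.det_apply]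
    exact ContDiffAt.sum fun σ _ => (contDiffAt_prod fun i _ => hN _ _).const_smul _
  simp only [Matrix.inv_def, Matrix.smul_apply, smul_eq_mul, Ring.inverse_eq_inv',
    Matrix.adjugate_apply]
  refine ((det hM).inv hdet).mul (det fun a b => ?_)
  simp only [Matrix.updateRow_apply]
  split_ifs
  · exact contDiffAt_const
  · exact hM a b

variable {w₀ : Config n} {h₁ h₂ : ℝ → (Fin n → ℝ) → ℝ} {C : ℝ}

/-- The separated identity forces the singular constant to vanish. -/
theorem separated_constant_eq_zero (hw₀ : Function.Injective (pts w₀))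
    (hsep : ∀ {x y : ℝ} {z : Fin n → ℝ}, (x, y, z) ∈ chamber w₀ →
      ∑ i, (z i - y) ^ 2 * pderiv i (h₂ y) z / (z i - x) -
        ∑ i, (z i - x) ^ 2 * pderiv i (h₁ x) z / (z i - y) = C / (x - y) ^ 2) : C = 0 := by
  have hw : (w₀.1, w₀.2.1, w₀.2.2) ∈ chamber w₀ := self_mem_chamber w₀
  obtain ⟨I, hI, J, hJ, V, hV, h⟩ := exists_box hw
  have h' := fun x hx y hy => h x hx y hy _ (mem_of_mem_nhds hV)
  exact double_pole_coeff_eq_zero (injective_marked hw₀) (infinite_of_mem_nhds _ hI)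
    (infinite_of_mem_nhds _ hJ)
    (fun x hx i => ((distinct hw₀ (h' x hx _ (mem_of_mem_nhds hJ))).2.1 i).symm)
    (fun y hy i => ((distinct hw₀ (h' _ (mem_of_mem_nhds hI) y hy)).2.2.1 i).symm)
    (fun x hx y hy => (distinct hw₀ (h' x hx y hy)).1.symm)
    (G := fun i y => (w₀.2.2 i - y) ^ 2 * pderiv i (h₂ y) w₀.2.2)
    (K := fun i x => (w₀.2.2 i - x) ^ 2 * pderiv i (h₁ x) w₀.2.2)
    (fun x hx y hy => hsep (h' x hx y hy))

/-- On the whole fibre over `z`, the derivatives of the zero order terms are given by one matrix. -/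
theorem exists_matrix (hw₀ : Function.Injective (pts w₀))
    (hsep : ∀ {x y : ℝ} {z : Fin n → ℝ}, (x, y, z) ∈ chamber w₀ →
      ∑ i, (z i - y) ^ 2 * pderiv i (h₂ y) z / (z i - x) =
        ∑ i, (z i - x) ^ 2 * pderiv i (h₁ x) z / (z i - y)) (z : Fin n → ℝ) :
    ∃ m : Fin n → Fin n → ℝ, ∀ x y, (x, y, z) ∈ chamber w₀ →
      (∀ i, (z i - y) ^ 2 * pderiv i (h₂ y) z = ∑ j, m i j / (z j - y)) ∧
      ∀ j, (z j - x) ^ 2 * pderiv j (h₁ x) z = ∑ i, m i j / (z i - x) := by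
  have loc : ∀ p : ℝ × ℝ, ∃ m : Fin n → Fin n → ℝ, (p.1, p.2, z) ∈ chamber w₀ →
      (∀ᶠ y in 𝓝 p.2, ∀ i, (z i - y) ^ 2 * pderiv i (h₂ y) z = ∑ j, m i j / (z j - y)) ∧
      ∀ j, (z j - p.1) ^ 2 * pderiv j (h₁ p.1) z = ∑ i, m i j / (z i - p.1) := by
    intro p
    by_cases hp : (p.1, p.2, z) ∈ chamber w₀
    · obtain ⟨I, hI, J, hJ, V, hV, h⟩ := exists_box hp
      have h' := fun x hx y hy => h x hx y hy _ (mem_of_mem_nhds hV)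
      obtain ⟨m, m1, m2⟩ := exists_pole_matrix (distinct hw₀ hp).2.2.2 (infinite_of_mem_nhds _ hI)
        (infinite_of_mem_nhds _ hJ)
        (fun x hx i => ((distinct hw₀ (h' x hx _ (mem_of_mem_nhds hJ))).2.1 i).symm)
        (fun y hy i => ((distinct hw₀ (h' _ (mem_of_mem_nhds hI) y hy)).2.2.1 i).symm)
        (G := fun i y => (z i - y) ^ 2 * pderiv i (h₂ y) z)
        (K := fun i x => (z i - x) ^ 2 * pderiv i (h₁ x) z)
        (fun x hx y hy => hsep (h' x hx y hy))
      exact ⟨m, fun _ => ⟨Filter.eventually_of_mem hJ m1, m2 _ (mem_of_mem_nhds hI)⟩⟩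
    · exact ⟨0, fun h => absurd h hp⟩
  choose m hm using loc
  set F : Set (ℝ × ℝ) := {p | (p.1, p.2, z) ∈ chamber w₀} with hF
  have hconv : Convex ℝ F := by
    intro p hp q hq s t hs ht hst
    have := convex_chamber w₀ hp hq hs ht hst
    have e : s • z + t • z = z := by rw [← add_smul, hst, one_smul]
    simp only [Prod.smul_mk, Prod.mk_add_mk, e] at this
    exact this
  -- The matrix is locally constant along the fibre, which is convex.
  have hconst : ∀ p ∈ F, ∀ q ∈ F, m p = m q := by
    intro p hp q hq
    refine hconv.isPreconnected.induction₂ (fun p q => m p = m q) (fun p hp => ?_)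
      (fun _ _ _ _ _ _ h h' => h.trans h') (fun _ _ _ _ h => h.symm) hp hq
    have ev := (continuous_snd.tendsto p).eventually (eventually_eventually_nhds.2 (hm p hp).1)
    filter_upwards [mem_nhdsWithin_of_mem_nhds ev, self_mem_nhdsWithin] with q hq1 hq
    have hq2 := (hm q hq).1
    have hq3 : ∀ᶠ y in 𝓝 q.2, ∀ i, z i ≠ y := by
      refine Filter.eventually_all.2 fun i => ?_
      exact (eventually_ne_nhds ((distinct hw₀ hq).2.2.1 i).symm).mono fun y hy => hy.symm
    have hS := hq1.and (hq2.and hq3)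
    funext i
    refine simple_pole_independent (distinct hw₀ hq).2.2.2 (infinite_of_mem_nhds _ hS)
      (fun t ht i => (ht.2.2 i).symm) fun t ht => ?_
    rw [← ht.1 i, ← ht.2.1 i]
  by_cases hne : F.Nonempty
  · obtain ⟨p, hp⟩ := hne
    refine ⟨m p, fun x y hxy => ?_⟩
    rw [hconst p hp (x, y) hxy]
    exact ⟨(hm (x, y) hxy).1.self_of_nhds, (hm (x, y) hxy).2⟩
  · exact ⟨0, fun x y hxy => absurd ⟨(x, y), hxy⟩ hne⟩

theorem pderiv_eq_fderiv {g : (Fin n → ℝ) → ℝ} {z : Fin n → ℝ} (hg : DifferentiableAt ℝ g z)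
    (i : Fin n) : pderiv i g z = fderiv ℝ g z (Pi.single i 1) := by
  have h : HasFDerivAt g (fderiv ℝ g z) (Function.update z i (z i)) := by
    rw [Function.update_eq_self]; exact hg.hasFDerivAt
  exact (h.comp_hasDerivAt (z i) (hasDerivAt_update z i (z i))).deriv

theorem contDiffAt_pderiv {g : (Fin n → ℝ) → ℝ} {z : Fin n → ℝ} (hg : ContDiffAt ℝ ∞ g z)
    (i : Fin n) : ContDiffAt ℝ ∞ (pderiv i g) z := by
  have h : ∀ᶠ u in 𝓝 z, DifferentiableAt ℝ g u := by
    have := (hg.of_le (m := 1) (by norm_cast)).eventually (by simp)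
    exact this.mono fun u hu => hu.differentiableAt (by simp)
  refine ContDiffAt.congr_of_eventuallyEq (f := fun u => fderiv ℝ g u (Pi.single i 1)) ?_
    (h.mono fun u hu => pderiv_eq_fderiv hu i)
  exact (hg.fderiv_right (m := ∞) (by norm_cast)).clm_apply contDiffAt_const

/-- The pole matrix depends smoothly on the marked points, as it is recovered from finitely many
values by the inverse of a Cauchy matrix. -/
theorem contDiffAt_matrix (hw₀ : Function.Injective (pts w₀))
    (hs : ∀ {x y : ℝ} {z : Fin n → ℝ}, (x, y, z) ∈ chamber w₀ → ContDiffAt ℝ ∞ (h₂ y) z)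
    {m : (Fin n → ℝ) → Fin n → Fin n → ℝ}
    (hm : ∀ z x y, (x, y, z) ∈ chamber w₀ →
      ∀ i, (z i - y) ^ 2 * pderiv i (h₂ y) z = ∑ j, m z i j / (z j - y))
    {z : Fin n → ℝ} (hz : z ∈ markedChamber w₀.2.2) (i j : Fin n) :
    ContDiffAt ℝ ∞ (fun z => m z i j) z := by
  obtain ⟨x, y, hw⟩ := exists_mem_chamber hz
  obtain ⟨I, hI, J, hJ, V, hV, h⟩ := exists_box hw
  have h' := fun y hy z hz => h x (mem_of_mem_nhds hI) y hy z hz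
  obtain ⟨t, htJ, ht⟩ : ∃ t : Fin n → ℝ, (∀ l, t l ∈ J) ∧ Function.Injective t := by
    let e := (infinite_of_mem_nhds _ hJ).natEmbedding
    exact ⟨fun l => e l, fun l => (e _).2, fun l l' hl =>
      Fin.ext (e.injective (Subtype.ext hl))⟩
  have hzV : z ∈ V := mem_of_mem_nhds hV
  have hne : ∀ z ∈ V, ∀ i k, z i ≠ t k := fun z hz i k =>
    (distinct hw₀ (h' _ (htJ k) z hz)).2.2.1 i
  have hco : ∀ i : Fin n, ContDiffAt ℝ ∞ (fun z : Fin n → ℝ => z i) z := fun i =>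
    (ContinuousLinearMap.proj (R := ℝ) (φ := fun _ : Fin n => ℝ) i).contDiff.contDiffAt
  have hinj : Function.Injective z := (distinct hw₀ hw).2.2.2
  refine ContDiffAt.congr_of_eventuallyEq (f := fun z => ∑ k, (cauchy z t)⁻¹ j k *
    ((z i - t k) ^ 2 * pderiv i (h₂ (t k)) z)) ?_ ?_
  · refine ContDiffAt.sum fun k _ => ContDiffAt.mul ?_ ?_
    · refine contDiffAt_matrix_inv (M := fun u => cauchy u t) (fun a b => ?_)
        (cauchy_det_ne_zero hinj ht (hne z hzV)) j k
      simp only [cauchy, Matrix.of_apply]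
      exact contDiffAt_const.div ((hco b).sub contDiffAt_const) (sub_ne_zero.2 (hne z hzV b a))
    · exact (((hco i).sub contDiffAt_const).pow 2).mul
        (contDiffAt_pderiv (hs (h' _ (htJ k) z hzV)) i)
  · filter_upwards [hV] with u hu
    refine eq_cauchy_inv_sum (p := u) (t := t) ?_ ht (hne u hu)
      (r := fun k => (u i - t k) ^ 2 * pderiv i (h₂ (t k)) u)
      (fun k => hm u x _ (h' _ (htJ k) u hu) i) j
    exact (distinct hw₀ (h' y (mem_of_mem_nhds hJ) u hu)).2.2.2

end

/-! ### Partial fractions -/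

section

variable {n : ℕ}

/-- The sum of double and simple poles at the marked points with coefficients `α` and `β`. -/
noncomputable def poleSum (α β : Fin n → ℝ) (z : Fin n → ℝ) (x : ℝ) : ℝ :=
  ∑ i, (α i / (x - z i) ^ 2 + β i / (x - z i))

/-- The residue at `z_i` of `-1/2 ∑ m_ij / ((z_i - x) (z_j - x))`. The term `j = i` is `0` by the
convention for division by zero. -/
noncomputable def residue (m : Fin n → Fin n → ℝ) (z : Fin n → ℝ) (i : Fin n) : ℝ :=
  -(1 / 2) * ∑ j, (m i j + m j i) / (z i - z j)

theorem bilinear_eq_poleSum (m : Fin n → Fin n → ℝ) {z : Fin n → ℝ} (hz : Function.Injective z)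
    {x : ℝ} (hx : ∀ i, z i ≠ x) :
    -(1 / 2) * ∑ j, ∑ i, m i j / ((z i - x) * (z j - x)) =
      poleSum (fun i => -m i i / 2) (residue m z) z x := by
  have key : ∀ i j, m i j / ((z i - x) * (z j - x)) =
      (if i = j then m i i / (x - z i) ^ 2 else 0) +
        (m i j / (z i - z j) / (x - z i) - m i j / (z i - z j) / (x - z j)) := by
    intro i j
    have h1 : z i - x ≠ 0 := sub_ne_zero.2 (hx i)
    have h2 : z j - x ≠ 0 := sub_ne_zero.2 (hx j)
    have h3 : x - z i ≠ 0 := sub_ne_zero.2 (hx i).symm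
    have h4 : x - z j ≠ 0 := sub_ne_zero.2 (hx j).symm
    by_cases h : i = j
    · subst h
      simp only [if_true, sub_self, div_zero, zero_div, add_zero]
      rw [← sq, ← neg_sub x, neg_sq]
    · have h5 : z i - z j ≠ 0 := sub_ne_zero.2 (hz.ne h)
      simp only [h, if_false, zero_add]
      field_simp
      ring
  have h1 : ∑ j, ∑ i, m i j / (z i - z j) / (x - z i) =
      ∑ i, (∑ j, m i j / (z i - z j)) / (x - z i) := by
    rw [Finset.sum_comm]; simp only [Finset.sum_div]
  have h2 : ∑ j, ∑ i, m i j / (z i - z j) / (x - z j) =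
      -∑ i, (∑ j, m j i / (z i - z j)) / (x - z i) := by
    rw [← Finset.sum_neg_distrib]
    refine Finset.sum_congr rfl fun j _ => ?_
    rw [Finset.sum_div, ← Finset.sum_neg_distrib]
    refine Finset.sum_congr rfl fun i _ => ?_
    rw [← neg_sub (z j) (z i), div_neg, neg_div]
  simp only [key, Finset.sum_add_distrib, Finset.sum_sub_distrib, h1, h2, Finset.sum_ite_eq',
    Finset.mem_univ, if_true, poleSum, residue]
  rw [sub_neg_eq_add, ← Finset.sum_add_distrib, ← Finset.sum_add_distrib, Finset.mul_sum,
    ← Finset.sum_add_distrib]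
  refine Finset.sum_congr rfl fun i _ => ?_
  simp only [add_div, Finset.sum_add_distrib]
  ring

/-- Partial fractions of a product of a simple and a double pole. The terms `i = l` on the right
are `0` by the convention for division by zero. -/
theorem triple_pole_eq (M : Fin n → ℝ) {z : Fin n → ℝ} (hz : Function.Injective z) {x : ℝ}
    (hx : ∀ i, z i ≠ x) (l : Fin n) :
    (∑ i, M i / (z i - x)) / (z l - x) ^ 2 = -M l / (x - z l) ^ 3 -
      (∑ i, M i / (z l - z i)) / (x - z l) ^ 2 + (∑ i, M i / (z l - z i) ^ 2) / (x - z l) -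
      ∑ i, M i / (z l - z i) ^ 2 / (x - z i) := by
  have key : ∀ i, M i / (z i - x) / (z l - x) ^ 2 =
      (if i = l then -M l / (x - z l) ^ 3 else 0) - M i / (z l - z i) / (x - z l) ^ 2 +
        M i / (z l - z i) ^ 2 / (x - z l) - M i / (z l - z i) ^ 2 / (x - z i) := by
    intro i
    have h1 : z i - x ≠ 0 := sub_ne_zero.2 (hx i)
    have h2 : z l - x ≠ 0 := sub_ne_zero.2 (hx l)
    have h3 : x - z i ≠ 0 := sub_ne_zero.2 (hx i).symm
    have h4 : x - z l ≠ 0 := sub_ne_zero.2 (hx l).symm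
    by_cases h : i = l
    · subst h
      simp only [if_true, sub_self, div_zero, zero_div, ne_eq, OfNat.ofNat_ne_zero,
        not_false_eq_true, zero_pow, add_zero, sub_zero]
      rw [← neg_sub x (z i)]
      field_simp
    · have h5 : z l - z i ≠ 0 := sub_ne_zero.2 (hz.ne (Ne.symm h))
      simp only [h, if_false, zero_sub]
      field_simp
      ring
  simp only [Finset.sum_div, key, Finset.sum_add_distrib, Finset.sum_sub_distrib,
    Finset.sum_ite_eq', Finset.mem_univ, if_true]

theorem hasDerivAt_comp_update {g : (Fin n → ℝ) → ℝ} {z : Fin n → ℝ} (hg : DifferentiableAt ℝ g z)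
    (l : Fin n) : HasDerivAt (fun t => g (Function.update z l t)) (pderiv l g z) (z l) := by
  have h : HasFDerivAt g (fderiv ℝ g z) (Function.update z l (z l)) := by
    rw [Function.update_eq_self]; exact hg.hasFDerivAt
  rw [pderiv_eq_fderiv hg]
  exact h.comp_hasDerivAt (z l) (hasDerivAt_update z l (z l))

theorem pderiv_congr {f g : (Fin n → ℝ) → ℝ} {z : Fin n → ℝ} (h : f =ᶠ[𝓝 z] g) (l : Fin n) :
    pderiv l f z = pderiv l g z := by
  refine Filter.EventuallyEq.deriv_eq ?_
  have : Filter.Tendsto (fun t => Function.update z l t) (𝓝 (z l)) (𝓝 z) := by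
    have := (hasDerivAt_update z l (z l)).continuousAt.tendsto
    rwa [Function.update_eq_self] at this
  exact this.eventually h

theorem fderiv_apply_eq_sum {g : (Fin n → ℝ) → ℝ} {z : Fin n → ℝ} (hg : DifferentiableAt ℝ g z)
    (v : Fin n → ℝ) : fderiv ℝ g z v = ∑ i, v i * pderiv i g z := by
  have : v = ∑ i, v i • (Pi.single i 1 : Fin n → ℝ) := by
    funext j
    simp [Finset.sum_apply, Pi.single_apply]
  conv_lhs => rw [this]
  simp only [map_sum, map_smul, smul_eq_mul, pderiv_eq_fderiv hg]

theorem pderiv_poleSum {α β : (Fin n → ℝ) → Fin n → ℝ} {z : Fin n → ℝ} {x : ℝ}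
    (hx : ∀ i, z i ≠ x) (hα : ∀ i, DifferentiableAt ℝ (fun u => α u i) z)
    (hβ : ∀ i, DifferentiableAt ℝ (fun u => β u i) z) (l : Fin n) :
    pderiv l (fun u => poleSum (α u) (β u) u x) z =
      ∑ i, (pderiv l (fun u => α u i) z / (x - z i) ^ 2 + pderiv l (fun u => β u i) z / (x - z i)) +
        2 * α z l / (x - z l) ^ 3 + β z l / (x - z l) ^ 2 := by
  have hc : ∀ i, HasDerivAt (fun t => x - Function.update z l t i) (if i = l then -1 else 0)
      (z l) := by
    intro i
    by_cases h : i = l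
    · subst h
      simpa using (hasDerivAt_id (z i)).const_sub x
    · simpa [h] using hasDerivAt_const (z l) (x - z i)
  have ht : ∀ i, HasDerivAt (fun t => α (Function.update z l t) i /
      (x - Function.update z l t i) ^ 2 + β (Function.update z l t) i /
        (x - Function.update z l t i))
      ((pderiv l (fun u => α u i) z / (x - z i) ^ 2 + pderiv l (fun u => β u i) z / (x - z i)) +
        if i = l then 2 * α z l / (x - z l) ^ 3 + β z l / (x - z l) ^ 2 else 0) (z l) := by
    intro i
    have hne : x - z i ≠ 0 := sub_ne_zero.2 (hx i).symm
    have h1 := (hasDerivAt_comp_update (hα i) l).div ((hc i).pow 2)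
      (by simpa only [Function.update_eq_self, Pi.pow_apply] using pow_ne_zero 2 hne)
    have h2 := (hasDerivAt_comp_update (hβ i) l).div (hc i)
      (by simpa only [Function.update_eq_self] using hne)
    refine (h1.add h2).congr_deriv ?_
    simp only [Function.update_eq_self, Pi.pow_apply]
    by_cases h : i = l
    · subst h
      simp only [if_true]
      field_simp
      ring
    · simp only [h, if_false]
      field_simp
      ring
  have := (HasDerivAt.fun_sum fun i (_ : i ∈ Finset.univ) => ht i).deriv
  rw [pderiv]
  simp only [poleSum]
  rw [this, Finset.sum_add_distrib, Finset.sum_ite_eq', if_pos (Finset.mem_univ l)]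
  ring

/-- Comparison of the derivative of a sum of poles at moving points with a sum of products of
poles: the derivatives of the coefficients. -/
theorem pderiv_coeffs {α β : (Fin n → ℝ) → Fin n → ℝ} {z : Fin n → ℝ} (hz : Function.Injective z)
    (hα : ∀ i, DifferentiableAt ℝ (fun u => α u i) z)
    (hβ : ∀ i, DifferentiableAt ℝ (fun u => β u i) z) {S : Set ℝ} (hS : S.Infinite)
    (hSz : ∀ x ∈ S, ∀ i, z i ≠ x) (l : Fin n) (M : Fin n → ℝ)
    (h : ∀ x ∈ S, (z l - x) ^ 2 * pderiv l (fun u => poleSum (α u) (β u) u x) z =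
      ∑ i, M i / (z i - x)) (i : Fin n) :
    pderiv l (fun u => α u i) z = (if i = l then -(β z l + ∑ k, M k / (z l - z k)) else 0) ∧
    pderiv l (fun u => β u i) z =
      (if i = l then ∑ k, M k / (z l - z k) ^ 2 else 0) - M i / (z l - z i) ^ 2 := by
  have key := pole_independent hz hS (fun x hx i => (hSz x hx i).symm) 3
    (fun i s => if s = 0 then pderiv l (fun u => β u i) z -
        ((if i = l then ∑ k, M k / (z l - z k) ^ 2 else 0) - M i / (z l - z i) ^ 2)
      else if s = 1 then pderiv l (fun u => α u i) z -
        (if i = l then -(β z l + ∑ k, M k / (z l - z k)) else 0)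
      else (if i = l then 2 * α z l + M l else 0))
    (fun x hx => by
      have hne : z l - x ≠ 0 := sub_ne_zero.2 (hSz x hx l)
      have e : pderiv l (fun u => poleSum (α u) (β u) u x) z =
          (∑ i, M i / (z i - x)) / (z l - x) ^ 2 := by
        rw [eq_div_iff (pow_ne_zero 2 hne), ← h x hx, mul_comm]
      rw [triple_pole_eq M hz (hSz x hx) l, pderiv_poleSum (hSz x hx) hα hβ l] at e
      simp only [Finset.sum_range_succ, Finset.sum_range_zero, zero_add, if_true, one_ne_zero,
        if_false, pow_one, OfNat.ofNat_ne_zero, OfNat.ofNat_ne_one, sub_div, ite_div, zero_div,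
        Finset.sum_add_distrib, Finset.sum_sub_distrib, Finset.sum_ite_eq', Finset.mem_univ,
        Nat.reduceAdd] at e ⊢
      simp only [add_div, neg_div] at e ⊢
      linear_combination e)
  exact ⟨by simpa [sub_eq_zero] using key i 1 (by norm_num),
    by simpa [sub_eq_zero] using key i 0 (by norm_num)⟩

end

/-! ### The potential of the simple poles -/

section

variable {n : ℕ}

theorem add_mem_markedChamber {z₀ z : Fin n → ℝ} (hz : z ∈ markedChamber z₀) (c : ℝ) :
    (fun i => z i + c) ∈ markedChamber z₀ := fun i j h => by
  simpa using hz i j h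

theorem mul_mem_markedChamber {z₀ z : Fin n → ℝ} (hz : z ∈ markedChamber z₀) {r : ℝ} (hr : 0 < r) :
    (fun i => r * z i) ∈ markedChamber z₀ := fun i j h =>
  mul_lt_mul_of_pos_left (hz i j h) hr

/-- A function on a marked chamber whose partial derivatives vanish is constant. -/
theorem eq_of_pderiv_eq_zero {z₀ : Fin n → ℝ} {g : (Fin n → ℝ) → ℝ}
    (hg : ∀ z ∈ markedChamber z₀, DifferentiableAt ℝ g z)
    (h : ∀ z ∈ markedChamber z₀, ∀ i, pderiv i g z = 0) {z z' : Fin n → ℝ}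
    (hz : z ∈ markedChamber z₀) (hz' : z' ∈ markedChamber z₀) : g z = g z' := by
  refine (convex_markedChamber z₀).is_const_of_fderivWithin_eq_zero (𝕜 := ℝ)
    (fun u hu => (hg u hu).differentiableWithinAt) (fun u hu => ?_) hz hz'
  rw [fderivWithin_of_isOpen (isOpen_markedChamber z₀) hu]
  ext v
  simp [fderiv_apply_eq_sum (hg u hu), h u hu]

/-- A smooth closed one-form on a marked chamber is exact. -/
theorem exists_primitive {z₀ : Fin n → ℝ} {b : (Fin n → ℝ) → Fin n → ℝ}
    (hb : ∀ z ∈ markedChamber z₀, ∀ i, ContDiffAt ℝ ∞ (fun u => b u i) z)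
    (hclosed : ∀ z ∈ markedChamber z₀, ∀ i j,
      pderiv i (fun u => b u j) z = pderiv j (fun u => b u i) z) :
    ∃ L : (Fin n → ℝ) → ℝ, ContDiffOn ℝ ∞ L (markedChamber z₀) ∧
      ∀ z ∈ markedChamber z₀, ∀ i, pderiv i L z = b z i := by
  set Ω : (Fin n → ℝ) → (Fin n → ℝ) →L[ℝ] ℝ := fun z =>
    ∑ i, b z i • ContinuousLinearMap.proj (R := ℝ) (φ := fun _ : Fin n => ℝ) i with hΩ
  have hsm : ∀ z ∈ markedChamber z₀, ContDiffAt ℝ ∞ Ω z := fun z hz =>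
    ContDiffAt.sum fun i _ => (hb z hz i).smul contDiffAt_const
  have hd : ∀ z ∈ markedChamber z₀, ∀ i, DifferentiableAt ℝ (fun u => b u i) z := fun z hz i =>
    (hb z hz i).differentiableAt (by simp)
  obtain ⟨L, hL⟩ := (convex_markedChamber z₀).exists_forall_hasFDerivAt_of_fderiv_symmetric
    (𝕜 := ℝ) (isOpen_markedChamber z₀)
    (show DifferentiableOn ℝ Ω _ from fun z hz =>
      ((hsm z hz).differentiableAt (by simp)).differentiableWithinAt)
    (fun z hz u v => by
      have key : ∀ u v, fderiv ℝ Ω z u v = ∑ j, ∑ i, u i * v j * pderiv i (fun u => b u j) z := by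
        intro u v
        have : HasFDerivAt Ω (∑ i, (fderiv ℝ (fun u => b u i) z).smulRight
            (ContinuousLinearMap.proj (R := ℝ) (φ := fun _ : Fin n => ℝ) i)) z :=
          HasFDerivAt.fun_sum fun i _ => (hd z hz i).hasFDerivAt.smul_const
            (ContinuousLinearMap.proj (R := ℝ) (φ := fun _ : Fin n => ℝ) i)
        rw [this.fderiv, sum_apply, sum_apply]
        refine Finset.sum_congr rfl fun j _ => ?_
        rw [ContinuousLinearMap.smulRight_apply, smul_apply,
          fderiv_apply_eq_sum (hd z hz j), ContinuousLinearMap.proj_apply, smul_eq_mul,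
          Finset.sum_mul]
        exact Finset.sum_congr rfl fun i _ => by ring
      rw [key, key, Finset.sum_comm]
      refine Finset.sum_congr rfl fun i _ => Finset.sum_congr rfl fun j _ => ?_
      rw [hclosed z hz i j]; ring)
  refine ⟨L, ?_, fun z hz i => ?_⟩
  · refine (contDiffOn_infty_iff_fderiv_of_isOpen (isOpen_markedChamber z₀)).2 ⟨fun z hz =>
      (hL z hz).differentiableAt.differentiableWithinAt, fun z hz => ?_⟩
    exact ((hsm z hz).contDiffWithinAt).congr (fun u hu => (hL u hu).fderiv) (hL z hz).fderiv
  · rw [pderiv_eq_fderiv (hL z hz).differentiableAt, (hL z hz).fderiv, hΩ,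
      sum_apply]
    simp [Pi.single_apply]

/-- If the radial component of the differential is constant and the translation component is zero,
the function is translation invariant and logarithmically homogeneous. -/
theorem invariance_of_pderiv {z₀ : Fin n → ℝ} {L : (Fin n → ℝ) → ℝ} {e : ℝ}
    (hd : ∀ z ∈ markedChamber z₀, DifferentiableAt ℝ L z)
    (ht : ∀ z ∈ markedChamber z₀, ∑ i, pderiv i L z = 0)
    (he : ∀ z ∈ markedChamber z₀, ∑ i, z i * pderiv i L z = e) :
    (∀ z ∈ markedChamber z₀, ∀ c, L (fun i => z i + c) = L z) ∧
    ∀ z ∈ markedChamber z₀, ∀ r, 0 < r → L (fun i => r * z i) = L z + e * Real.log r := by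
  constructor
  · intro z hz c
    have hder : ∀ t : ℝ, HasDerivAt (fun t => L fun i => z i + t) 0 t := by
      intro t
      have hmem := add_mem_markedChamber hz t
      have hc : HasDerivAt (fun t : ℝ => fun i => z i + t) (fun _ => (1 : ℝ)) t :=
        hasDerivAt_pi.2 fun i => (hasDerivAt_id t).const_add (z i)
      have := (hd _ hmem).hasFDerivAt.comp_hasDerivAt t hc
      rw [fderiv_apply_eq_sum (hd _ hmem)] at this
      simp only [one_mul, ht _ hmem] at this
      exact this
    have := is_const_of_deriv_eq_zero (fun t => (hder t).differentiableAt)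
      (fun t => (hder t).deriv) c 0
    simpa using this
  · intro z hz r hr
    have hder : ∀ t : ℝ, HasDerivAt (fun t => L (fun i => Real.exp t * z i) - e * t) 0 t := by
      intro t
      have hmem := mul_mem_markedChamber hz (Real.exp_pos t)
      have hc : HasDerivAt (fun t : ℝ => fun i => Real.exp t * z i)
          (fun i => Real.exp t * z i) t :=
        hasDerivAt_pi.2 fun i => (Real.hasDerivAt_exp t).mul_const (z i)
      have := (hd _ hmem).hasFDerivAt.comp_hasDerivAt t hc
      rw [fderiv_apply_eq_sum (hd _ hmem), he _ hmem] at this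
      exact (this.sub ((hasDerivAt_id t).const_mul e)).congr_deriv (by simp)
    have := is_const_of_deriv_eq_zero (fun t => (hder t).differentiableAt)
      (fun t => (hder t).deriv) (Real.log r) 0
    simp only [Real.exp_log hr, Real.exp_zero, one_mul, mul_zero, sub_zero] at this
    linarith

variable {w₀ : Config n} {h₁ h₂ : ℝ → (Fin n → ℝ) → ℝ}

/-- The normal form of the zero order terms: double poles with constant coefficients, plus the
Loewner derivative of a translation invariant, logarithmically homogeneous function `L` of the
marked points. -/
structure NormalForm (w₀ : Config n) (h₁ h₂ : ℝ → (Fin n → ℝ) → ℝ) (α : Fin n → ℝ)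
    (L : (Fin n → ℝ) → ℝ) (e : ℝ) : Prop where
  smooth : ContDiffOn ℝ ∞ L (markedChamber w₀.2.2)
  trans : ∀ z ∈ markedChamber w₀.2.2, ∀ c, L (fun i => z i + c) = L z
  dil : ∀ z ∈ markedChamber w₀.2.2, ∀ r, 0 < r → L (fun i => r * z i) = L z + e * Real.log r
  eq : ∀ x y z, (x, y, z) ∈ chamber w₀ →
    h₁ x z = ∑ i, α i / (x - z i) ^ 2 + markedFlow x L z ∧
    h₂ y z = ∑ i, α i / (y - z i) ^ 2 + markedFlow y L z

/-- The separated identity and Euler's relations `2 h = -∑ (z_i - x) ∂_i h` bring the zero order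
terms to normal form: the pole matrix is symmetric, its diagonal is constant, and the residues of
the simple poles are the components of a closed one-form. -/
theorem exists_normalForm (hw₀ : Function.Injective (pts w₀))
    (hsep : ∀ {x y : ℝ} {z : Fin n → ℝ}, (x, y, z) ∈ chamber w₀ →
      ContDiffAt ℝ ∞ (h₁ x) z ∧ ContDiffAt ℝ ∞ (h₂ y) z ∧
      2 * h₁ x z = -∑ i, (z i - x) * pderiv i (h₁ x) z ∧
      2 * h₂ y z = -∑ i, (z i - y) * pderiv i (h₂ y) z ∧
      ∑ i, (z i - y) ^ 2 * pderiv i (h₂ y) z / (z i - x) =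
        ∑ i, (z i - x) ^ 2 * pderiv i (h₁ x) z / (z i - y)) :
    ∃ α L e, NormalForm w₀ h₁ h₂ α L e := by
  choose m hm using fun z => exists_matrix hw₀ (fun hw => (hsep hw).2.2.2.2) z
  have hmsm : ∀ z ∈ markedChamber w₀.2.2, ∀ i j, ContDiffAt ℝ ∞ (fun z => m z i j) z :=
    fun z hz i j => contDiffAt_matrix hw₀ (fun hw => (hsep hw).2.1)
      (fun z x y hw => (hm z x y hw).1) hz i j
  have hinj : ∀ z ∈ markedChamber w₀.2.2, Function.Injective z := fun z hz =>
    injective_of_mem_markedChamber (injective_marked hw₀) hz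
  set α : (Fin n → ℝ) → Fin n → ℝ := fun z i => -m z i i / 2 with hα
  set β : (Fin n → ℝ) → Fin n → ℝ := fun z => residue (m z) z with hβ
  have hαsm : ∀ z ∈ markedChamber w₀.2.2, ∀ i, ContDiffAt ℝ ∞ (fun u => α u i) z :=
    fun z hz i => (hmsm z hz i i).neg.div_const 2
  have hβsm : ∀ z ∈ markedChamber w₀.2.2, ∀ i, ContDiffAt ℝ ∞ (fun u => β u i) z := by
    intro z hz i
    refine contDiffAt_const.mul (ContDiffAt.sum fun j _ => ?_)
    by_cases hij : i = j
    · subst hij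
      simpa using contDiffAt_const
    · have hco : ∀ i : Fin n, ContDiffAt ℝ ∞ (fun z : Fin n → ℝ => z i) z := fun i =>
        (ContinuousLinearMap.proj (R := ℝ) (φ := fun _ : Fin n => ℝ) i).contDiff.contDiffAt
      exact ((hmsm z hz i j).add (hmsm z hz j i)).div ((hco i).sub (hco j))
        (sub_ne_zero.2 ((hinj z hz).ne hij))
  have hαd := fun z hz i => (hαsm z hz i).differentiableAt (by simp)
  have hβd := fun z hz i => (hβsm z hz i).differentiableAt (by simp)
  have form₁ : ∀ x y z, (x, y, z) ∈ chamber w₀ → h₁ x z = poleSum (α z) (β z) z x := by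
    intro x y z hw
    obtain ⟨-, hzx, -, hz⟩ := distinct hw₀ hw
    rw [hα, hβ, ← bilinear_eq_poleSum (m z) hz hzx]
    have e1 : ∑ i, (z i - x) * pderiv i (h₁ x) z =
        ∑ j, ∑ i, m z i j / ((z i - x) * (z j - x)) := by
      refine Finset.sum_congr rfl fun j _ => ?_
      have hne : z j - x ≠ 0 := sub_ne_zero.2 (hzx j)
      have e2 : (z j - x) * pderiv j (h₁ x) z = (z j - x) ^ 2 * pderiv j (h₁ x) z / (z j - x) := by
        field_simp
      rw [e2, (hm z x y hw).2 j, Finset.sum_div]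
      simp only [div_div]
    have := (hsep hw).2.2.1
    rw [e1] at this
    linarith
  have form₂ : ∀ x y z, (x, y, z) ∈ chamber w₀ → h₂ y z = poleSum (α z) (β z) z y := by
    intro x y z hw
    obtain ⟨-, -, hzy, hz⟩ := distinct hw₀ hw
    rw [hα, hβ, ← bilinear_eq_poleSum (m z) hz hzy, Finset.sum_comm]
    have e1 : ∑ i, (z i - y) * pderiv i (h₂ y) z =
        ∑ i, ∑ j, m z i j / ((z i - y) * (z j - y)) := by
      refine Finset.sum_congr rfl fun j _ => ?_
      have hne : z j - y ≠ 0 := sub_ne_zero.2 (hzy j)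
      have e2 : (z j - y) * pderiv j (h₂ y) z = (z j - y) ^ 2 * pderiv j (h₂ y) z / (z j - y) := by
        field_simp
      rw [e2, (hm z x y hw).1 j, Finset.sum_div]
      simp only [div_div, mul_comm]
    have := (hsep hw).2.2.2.1
    rw [e1] at this
    linarith
  have coeffs : ∀ z ∈ markedChamber w₀.2.2, ∀ l i,
      (pderiv l (fun u => α u i) z =
          (if i = l then -(β z l + ∑ k, m z k l / (z l - z k)) else 0) ∧
        pderiv l (fun u => β u i) z =
          (if i = l then ∑ k, m z k l / (z l - z k) ^ 2 else 0) - m z i l / (z l - z i) ^ 2) ∧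
      pderiv l (fun u => β u i) z =
        (if i = l then ∑ k, m z l k / (z l - z k) ^ 2 else 0) - m z l i / (z l - z i) ^ 2 := by
    intro z hz l i
    obtain ⟨x, y, hw⟩ := exists_mem_chamber hz
    obtain ⟨I, hI, J, hJ, V, hV, h⟩ := exists_box hw
    have hzV := mem_of_mem_nhds hV
    constructor
    · refine pderiv_coeffs (hinj z hz) (hαd z hz) (hβd z hz) (infinite_of_mem_nhds _ hI)
        (fun x' hx' => (distinct hw₀ (h x' hx' y (mem_of_mem_nhds hJ) z hzV)).2.1) l
        (fun k => m z k l) (fun x' hx' => ?_) i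
      rw [← (hm z x' y (h x' hx' y (mem_of_mem_nhds hJ) z hzV)).2 l]
      congr 1
      refine (pderiv_congr ?_ l).symm
      filter_upwards [hV] with u hu
      exact form₁ x' y u (h x' hx' y (mem_of_mem_nhds hJ) u hu)
    · refine (pderiv_coeffs (hinj z hz) (hαd z hz) (hβd z hz) (infinite_of_mem_nhds _ hJ)
        (fun y' hy' => (distinct hw₀ (h x (mem_of_mem_nhds hI) y' hy' z hzV)).2.2.1) l
        (fun k => m z l k) (fun y' hy' => ?_) i).2
      rw [← (hm z x y' (h x (mem_of_mem_nhds hI) y' hy' z hzV)).1 l]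
      congr 1
      refine (pderiv_congr ?_ l).symm
      filter_upwards [hV] with u hu
      exact form₂ x y' u (h x (mem_of_mem_nhds hI) y' hy' u hu)
  -- Both expressions for the derivatives of `β` agree, so the pole matrix is symmetric.
  have symm : ∀ z ∈ markedChamber w₀.2.2, ∀ i l, m z i l = m z l i := by
    intro z hz i l
    by_cases h : i = l
    · rw [h]
    · have e1 := (coeffs z hz l i).1.2
      rw [(coeffs z hz l i).2] at e1
      have hne : z l - z i ≠ 0 := sub_ne_zero.2 ((hinj z hz).ne (Ne.symm h))
      simp only [h, if_false, zero_sub, neg_inj] at e1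
      field_simp at e1
      exact e1.symm
  have hβeq : ∀ z ∈ markedChamber w₀.2.2, ∀ l, β z l = -∑ k, m z l k / (z l - z k) := by
    intro z hz l
    simp only [hβ, residue, symm z hz _ l, ← two_mul, mul_div_assoc, ← Finset.mul_sum]
    ring
  -- The residue formula is what makes the double pole coefficients constant.
  have hdα : ∀ z ∈ markedChamber w₀.2.2, ∀ l i, pderiv l (fun u => α u i) z = 0 := by
    intro z hz l i
    rw [(coeffs z hz l i).1.1, hβeq z hz l]
    simp only [symm z hz _ l, neg_add_cancel, neg_zero, ite_self]
  have hdβ := fun z hz l i => (coeffs z hz l i).2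
  have hz₀ : w₀.2.2 ∈ markedChamber w₀.2.2 := fun _ _ h => h
  obtain ⟨L, hLsm, hL⟩ := exists_primitive (b := fun z i => -β z i / 2)
    (fun z hz i => (hβsm z hz i).neg.div_const 2) (fun z hz i j => by
      have hs : ∀ l i, pderiv l (fun u => -β u i / 2) z = -pderiv l (fun u => β u i) z / 2 := by
        intro l i
        exact ((hasDerivAt_comp_update (hβd z hz i) l).neg.div_const 2).deriv
      rw [hs, hs, hdβ z hz, hdβ z hz]
      by_cases h : i = j
      · rw [h]
      · simp only [h, Ne.symm h, if_false]
        rw [symm z hz i j, ← neg_sub (z j) (z i), neg_sq])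
  have hLd : ∀ z ∈ markedChamber w₀.2.2, DifferentiableAt ℝ L z := fun z hz =>
    (hLsm.contDiffAt ((isOpen_markedChamber w₀.2.2).mem_nhds hz)).differentiableAt (by simp)
  have hflow : ∀ z ∈ markedChamber w₀.2.2, ∀ x, (∀ i, z i ≠ x) →
      poleSum (α z) (β z) z x = ∑ i, α w₀.2.2 i / (x - z i) ^ 2 + markedFlow x L z := by
    intro z hz x hx
    rw [poleSum, Finset.sum_add_distrib, markedFlow]
    congr 1
    · refine Finset.sum_congr rfl fun i _ => ?_
      rw [eq_of_pderiv_eq_zero (fun z hz => hαd z hz i) (fun z hz l => hdα z hz l i) hz hz₀]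
    · refine Finset.sum_congr rfl fun i _ => ?_
      have h1 : z i - x ≠ 0 := sub_ne_zero.2 (hx i)
      have h2 : x - z i ≠ 0 := sub_ne_zero.2 (hx i).symm
      rw [hL z hz i]
      field_simp
      ring
  -- By symmetry of the pole matrix, the residues `β` sum to zero.
  have hsum0 : ∀ z ∈ markedChamber w₀.2.2, ∑ i, pderiv i L z = 0 := by
    intro z hz
    simp only [hL z hz, hβeq z hz, neg_neg]
    rw [← Finset.sum_div]
    have e1 : ∑ l, ∑ k, m z l k / (z l - z k) = -∑ l, ∑ k, m z l k / (z l - z k) := by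
      conv_lhs => rw [Finset.sum_comm]
      rw [← Finset.sum_neg_distrib]
      refine Finset.sum_congr rfl fun i _ => ?_
      rw [← Finset.sum_neg_distrib]
      refine Finset.sum_congr rfl fun j _ => ?_
      rw [symm z hz j i, ← neg_sub (z i) (z j), div_neg]
    have : ∑ l, ∑ k, m z l k / (z l - z k) = 0 := by linarith
    rw [this, zero_div]
  -- The radial component `-1/2 ∑ z_i β_i` has zero partial derivatives, hence is constant.
  have hdiffsum : ∀ z ∈ markedChamber w₀.2.2, ∀ l, HasDerivAt
      (fun t => ∑ i, Function.update z l t i * (-β (Function.update z l t) i / 2)) 0 (z l) := by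
    intro z hz l
    have hc : ∀ i, HasDerivAt (fun t => Function.update z l t i) (if i = l then 1 else 0)
        (z l) := by
      intro i
      by_cases h : i = l
      · subst h; simpa using hasDerivAt_id' (z i)
      · simpa [h] using hasDerivAt_const (z l) (z i)
    have h1 := HasDerivAt.fun_sum fun i (_ : i ∈ Finset.univ) =>
      (hc i).mul ((hasDerivAt_comp_update (hβd z hz i) l).neg.div_const 2)
    refine h1.congr_deriv ?_
    simp only [Pi.neg_apply, Function.update_eq_self, hdβ z hz, ite_mul, one_mul, zero_mul,
      Finset.sum_add_distrib, Finset.sum_ite_eq', Finset.mem_univ, if_true, hβeq z hz, neg_neg,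
      neg_sub]
    have e1 : ∀ i, z i * ((m z l i / (z l - z i) ^ 2 -
        if i = l then ∑ k, m z l k / (z l - z k) ^ 2 else 0) / 2) =
        z i * (m z l i / (z l - z i) ^ 2) / 2 -
          if i = l then z l * (∑ k, m z l k / (z l - z k) ^ 2) / 2 else 0 := by
      intro i
      split_ifs with h
      · rw [h]; ring
      · ring
    simp only [e1, Finset.sum_sub_distrib, Finset.sum_ite_eq', Finset.mem_univ, if_true]
    rw [Finset.mul_sum, Finset.sum_div, Finset.sum_div, ← Finset.sum_sub_distrib,
      ← Finset.sum_add_distrib]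
    refine Finset.sum_eq_zero fun k _ => ?_
    by_cases h : z l - z k = 0
    · simp [h]
    · field_simp
      ring
  have hrad : ∀ z ∈ markedChamber w₀.2.2, ∑ i, z i * pderiv i L z =
      ∑ i, w₀.2.2 i * (-β w₀.2.2 i / 2) := by
    intro z hz
    simp only [hL z hz]
    refine eq_of_pderiv_eq_zero (g := fun z => ∑ i, z i * (-β z i / 2)) (fun z hz => ?_)
      (fun z hz l => (hdiffsum z hz l).deriv) hz hz₀
    have hd : ∀ i, DifferentiableAt ℝ (fun z => -β z i / 2) z := fun i =>
      (((hβsm z hz i).neg.div_const 2)).differentiableAt (by simp)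
    exact DifferentiableAt.fun_sum fun i _ => (differentiableAt_apply i z).mul (hd i)
  obtain ⟨ht, hr⟩ := invariance_of_pderiv hLd hsum0 hrad
  refine ⟨α w₀.2.2, L, _, hLsm, ht, hr, fun x y z hw => ?_⟩
  have hz := mem_markedChamber hw
  obtain ⟨-, hzx, hzy, -⟩ := distinct hw₀ hw
  rw [form₁ x y z hw, form₂ x y z hw]
  exact ⟨hflow z hz x hzx, hflow z hz y hzy⟩

end

/-! ### Weight vectors and their vertex sums -/

section

variable {n : ℕ}

/-- The symmetric matrix with zero diagonal of a weight vector. -/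
def symMatrix (ν : Pair n → ℝ) (i j : Fin (n + 1)) : ℝ :=
  if h : i < j then ν ⟨(i, j), h⟩ else if h : j < i then ν ⟨(j, i), h⟩ else 0

theorem symMatrix_comm (ν : Pair n → ℝ) (i j : Fin (n + 1)) :
    symMatrix ν i j = symMatrix ν j i := by
  rcases lt_trichotomy i j with h | rfl | h
  · simp [symMatrix, h, h.not_gt]
  · rfl
  · simp [symMatrix, h, h.not_gt]

theorem symMatrix_self (ν : Pair n → ℝ) (i : Fin (n + 1)) : symMatrix ν i i = 0 := by
  simp [symMatrix]

theorem symMatrix_pair (ν : Pair n → ℝ) (p : Pair n) : symMatrix ν p.1.1 p.1.2 = ν p := by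
  simp [symMatrix, p.2]

theorem symMatrix_add (ν ν' : Pair n → ℝ) (i j : Fin (n + 1)) :
    symMatrix (ν + ν') i j = symMatrix ν i j + symMatrix ν' i j := by
  unfold symMatrix; split_ifs <;> simp

theorem symMatrix_smul (c : ℝ) (ν : Pair n → ℝ) (i j : Fin (n + 1)) :
    symMatrix (c • ν) i j = c * symMatrix ν i j := by
  unfold symMatrix; split_ifs <;> simp

theorem symMatrix_sub (ν ν' : Pair n → ℝ) (i j : Fin (n + 1)) :
    symMatrix (ν - ν') i j = symMatrix ν i j - symMatrix ν' i j := by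
  unfold symMatrix; split_ifs <;> simp

theorem symMatrix_basisVec {i j : Fin (n + 1)} (hij : i ≠ j) (a b : Fin (n + 1)) :
    symMatrix (basisVec i j) a b = (if a = i ∧ b = j then 1 else 0) +
      if a = j ∧ b = i then 1 else 0 := by
  unfold symMatrix basisVec
  simp only [Prod.mk.injEq]
  grind

/-- The sum of the weights of the pairs that contain `i`. -/
def vertexSum (ν : Pair n → ℝ) (i : Fin (n + 1)) : ℝ := ∑ j, symMatrix ν i j

theorem vertexSum_sub (ν ν' : Pair n → ℝ) (i : Fin (n + 1)) :
    vertexSum (ν - ν') i = vertexSum ν i - vertexSum ν' i := by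
  simp only [vertexSum, symMatrix_sub, Finset.sum_sub_distrib]

theorem vertexSum_add (ν ν' : Pair n → ℝ) (i : Fin (n + 1)) :
    vertexSum (ν + ν') i = vertexSum ν i + vertexSum ν' i := by
  simp only [vertexSum, symMatrix_add, Finset.sum_add_distrib]

theorem vertexSum_smul (c : ℝ) (ν : Pair n → ℝ) (i : Fin (n + 1)) :
    vertexSum (c • ν) i = c * vertexSum ν i := by
  simp only [vertexSum, symMatrix_smul, Finset.mul_sum]

theorem vertexSum_basisVec {i j : Fin (n + 1)} (hij : i ≠ j) (a : Fin (n + 1)) :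
    vertexSum (basisVec i j) a = (if a = i then 1 else 0) + if a = j then 1 else 0 := by
  simp only [vertexSum, symMatrix_basisVec hij, Finset.sum_add_distrib, ite_and]
  congr 1 <;> split_ifs <;> simp

theorem two_mul_pair_sum (ν : Pair n → ℝ) {F : Fin (n + 1) → Fin (n + 1) → ℝ}
    (hF : ∀ i j, F i j = F j i) :
    2 * ∑ p : Pair n, ν p * F p.1.1 p.1.2 = ∑ i, ∑ j, symMatrix ν i j * F i j := by
  set G : Fin (n + 1) → Fin (n + 1) → ℝ := fun i j => symMatrix ν i j * F i j with hG
  have hs : ∀ i j, G i j = G j i := fun i j => by simp only [hG, symMatrix_comm ν i j, hF i j]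
  have h1 : ∑ p : Pair n, ν p * F p.1.1 p.1.2 = ∑ i, ∑ j, if i < j then G i j else 0 := by
    rw [← Fintype.sum_prod_type' (f := fun i j => if i < j then G i j else 0),
      ← Finset.sum_filter, ← Finset.sum_subtype_eq_sum_filter, Finset.subtype_univ]
    exact Finset.sum_congr rfl fun p _ => by rw [hG, ← symMatrix_pair ν p]
  have h2 : ∑ i, ∑ j, (if i < j then G i j else 0) = ∑ i, ∑ j, if j < i then G i j else 0 := by
    rw [Finset.sum_comm]
    refine Finset.sum_congr rfl fun i _ => Finset.sum_congr rfl fun j _ => ?_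
    rw [hs]
  rw [two_mul]
  nth_rewrite 2 [h1]
  rw [h1, h2]
  nth_rewrite 2 [← h2]
  simp only [← Finset.sum_add_distrib]
  refine Finset.sum_congr rfl fun i _ => Finset.sum_congr rfl fun j _ => ?_
  rcases lt_trichotomy i j with h | rfl | h
  · simp [h, h.not_gt, hG]
  · simp [symMatrix_self]
  · simp [h, h.not_gt, hG]

theorem eq_sum_basisVec (ν : Pair n → ℝ) : ν = ∑ p : Pair n, ν p • basisVec p.1.1 p.1.2 := by
  funext q
  rw [Finset.sum_apply, Finset.sum_eq_single q]
  · simp [basisVec]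
  · intro p _ hpq
    have h1 : q.1 ≠ (p.1.1, p.1.2) := fun h => hpq (Subtype.ext h.symm)
    have h2 : q.1 ≠ (p.1.2, p.1.1) := fun h => by
      have h3 := q.2
      rw [h] at h3
      exact absurd p.2 h3.not_gt
    simp [basisVec, h1, h2]
  · simp

theorem basisVec_comm (i j : Fin (n + 1)) : (basisVec i j : Pair n → ℝ) = basisVec j i := by
  funext p
  simp only [basisVec, or_comm]

/-- A symmetric function on pairs satisfying the four-point relations is a sum of one-point
functions. -/
theorem exists_potential_of_fourPoint {φ : Fin (n + 1) → Fin (n + 1) → ℝ}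
    (hs : ∀ i j, φ i j = φ j i)
    (h : ∀ i j k l, [i, j, k, l].Nodup → φ i j + φ k l = φ i l + φ j k) :
    ∃ c : Fin (n + 1) → ℝ, ∀ i j, i ≠ j → φ i j = c i + c j := by
  -- The defect `φ i j - φ 0 i - φ 0 j` is the same for all pairs `i ≠ j` of nonzero indices.
  have h0 : ∀ j k l : Fin (n + 1), j ≠ 0 → k ≠ 0 → l ≠ 0 → j ≠ k → k ≠ l → j ≠ l →
      φ j k - φ 0 j - φ 0 k = φ k l - φ 0 k - φ 0 l := by
    intro j k l hj hk hl hjk hkl hjl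
    have := h 0 j k l (by simp [hj.symm, hk.symm, hl.symm, hjk, hkl, hjl])
    linarith
  obtain ⟨K, hK⟩ : ∃ K, ∀ i j : Fin (n + 1), i ≠ 0 → j ≠ 0 → i ≠ j →
      φ i j - φ 0 i - φ 0 j = K := by
    by_cases hex : ∃ a b : Fin (n + 1), a ≠ 0 ∧ b ≠ 0 ∧ a ≠ b
    · obtain ⟨a, b, ha, hb, hab⟩ := hex
      refine ⟨φ a b - φ 0 a - φ 0 b, fun i j hi hj hij => ?_⟩
      have s1 := hs a b
      have s2 := hs i j
      by_cases hia : i = a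
      · subst hia
        by_cases hjb : j = b
        · rw [hjb]
        · have := h0 j i b hj hi hb hij.symm hab hjb
          linarith
      by_cases hib : i = b
      · subst hib
        by_cases hja : j = a
        · subst hja; linarith
        · have := h0 j i a hj hi ha hij.symm hab.symm hja
          linarith
      by_cases hja : j = a
      · subst hja
        exact h0 i j b hi hj hb hij hab hib
      by_cases hjb : j = b
      · subst hjb
        have := h0 i j a hi hj ha hij hab.symm hia
        linarith
      · have e1 := h0 i j a hi hj ha hij hja hia
        have e2 := h0 j a b hj ha hb hja hab hjb
        linarith
    · exact ⟨0, fun i j hi hj hij => absurd ⟨i, j, hi, hj, hij⟩ hex⟩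
  refine ⟨fun i => if i = 0 then -K / 2 else φ 0 i + K / 2, fun i j hij => ?_⟩
  by_cases hi : i = 0
  · subst hi
    simp only [if_true, hij.symm, if_false]
    ring
  · by_cases hj : j = 0
    · subst hj
      simp only [if_true, hij, if_false, hs i 0]
      ring
    · have := hK i j hi hj hij
      simp only [hi, hj, if_false]
      linarith

/-- The relations are exactly the weight vectors all of whose vertex sums vanish. -/
theorem mem_relations_iff (ν : Pair n → ℝ) : ν ∈ relations n ↔ ∀ i, vertexSum ν i = 0 := by
  constructor
  · intro h
    refine Submodule.span_induction (p := fun ν _ => ∀ i, vertexSum ν i = 0) ?_ ?_ ?_ ?_ h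
    · rintro _ ⟨i, j, k, l, hn, rfl⟩ a
      simp only [List.nodup_cons, List.mem_cons, List.not_mem_nil, or_false, not_or] at hn
      obtain ⟨⟨hij, hik, hil⟩, ⟨hjk, hjl⟩, hkl, -⟩ := hn
      rw [vertexSum_sub, vertexSum_sub, vertexSum_add, vertexSum_basisVec hij,
        vertexSum_basisVec hkl, vertexSum_basisVec hil, vertexSum_basisVec hjk]
      ring
    · intro i
      have := vertexSum_smul (0 : ℝ) (0 : Pair n → ℝ) i
      simpa using this
    · intro ν ν' _ _ h1 h2 i
      rw [vertexSum_add, h1, h2, add_zero]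
    · intro c ν _ h1 i
      rw [vertexSum_smul, h1, mul_zero]
  · intro h
    by_contra hν
    -- A linear form vanishing on the relations has the shape `e_ij ↦ c_i + c_j`, and so takes the
    -- value `∑ i, c_i * vertexSum ν i`.
    obtain ⟨f, hf0, hf⟩ := Submodule.exists_le_ker_of_notMem hν
    have hrel : ∀ i j k l : Fin (n + 1), [i, j, k, l].Nodup →
        f (basisVec i j) + f (basisVec k l) = f (basisVec i l) + f (basisVec j k) := by
      intro i j k l hn
      have : f (basisVec i j + basisVec k l - basisVec i l - basisVec j k) = 0 :=
        hf (Submodule.subset_span ⟨i, j, k, l, hn, rfl⟩)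
      simp only [map_sub, map_add] at this
      linarith
    obtain ⟨c, hc⟩ := exists_potential_of_fourPoint
      (φ := fun i j => f (basisVec i j)) (fun i j => by rw [basisVec_comm]) hrel
    refine hf0 ?_
    have e : f ν = ∑ p : Pair n, ν p * (c p.1.1 + c p.1.2) := by
      conv_lhs => rw [eq_sum_basisVec ν]
      simp only [map_sum, map_smul, smul_eq_mul]
      exact Finset.sum_congr rfl fun p _ => by rw [← hc _ _ p.2.ne]
    have e2 := two_mul_pair_sum ν (F := fun i j => c i + c j) (fun i j => add_comm _ _)
    simp only [mul_add, Finset.sum_add_distrib] at e2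
    have e3 : ∑ i, ∑ j, symMatrix ν i j * c i = 0 := by
      refine Finset.sum_eq_zero fun i _ => ?_
      rw [← Finset.sum_mul]
      exact mul_eq_zero_of_left (h i) _
    have e4 : ∑ i, ∑ j, symMatrix ν i j * c j = 0 := by
      rw [Finset.sum_comm]
      refine Finset.sum_eq_zero fun j _ => ?_
      rw [← Finset.sum_mul]
      simp only [symMatrix_comm ν _ j]
      exact mul_eq_zero_of_left (h j) _
    rw [e3, e4] at e2
    simp only [mul_add, Finset.sum_add_distrib] at e
    linarith

/-- With at least three vertices, the vertex sums of a weight vector can be prescribed. -/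
theorem exists_vertexSum (hn : 2 ≤ n) (s : Fin (n + 1) → ℝ) :
    ∃ ν : Pair n → ℝ, ∀ i, vertexSum ν i = s i := by
  have hn' : (2 : ℝ) ≤ n := by exact_mod_cast hn
  have h0 : (n : ℝ) ≠ 0 := by linarith
  have h1 : (n : ℝ) - 1 ≠ 0 := by linarith
  -- The solution of the form `c_i + c_j`.
  set G : Fin (n + 1) → Fin (n + 1) → ℝ := fun i j =>
    (s i + s j) / (n - 1) - (∑ k, s k) / (n * (n - 1)) with hG
  refine ⟨fun p => G p.1.1 p.1.2, fun i => ?_⟩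
  have e : ∀ j, symMatrix (fun p : Pair n => G p.1.1 p.1.2) i j =
      G i j - if i = j then G i j else 0 := by
    intro j
    rcases lt_trichotomy i j with h | rfl | h
    · simp [symMatrix, h, h.ne]
    · simp [symMatrix]
    · simp [symMatrix, h, h.ne', h.not_gt, hG, add_comm]
  simp only [vertexSum, e, Finset.sum_sub_distrib, Finset.sum_ite_eq, Finset.mem_univ, if_true]
  simp only [hG, Finset.sum_sub_distrib, ← Finset.sum_div, Finset.sum_add_distrib,
    Finset.sum_const, Finset.card_univ, Fintype.card_fin, nsmul_eq_mul]
  push_cast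
  field_simp
  ring

/-! ### Conformally invariant extensions -/

theorem withInfty_castSucc (z : Fin n → ℝ) (i : Fin n) :
    withInfty z i.castSucc = (z i : OnePoint ℝ) := by
  simp [withInfty]

theorem withInfty_last (z : Fin n → ℝ) : withInfty z (Fin.last n) = OnePoint.infty := by
  simp [withInfty]

/-- A Möbius transformation of positive determinant that carries finite marked points and `∞` to
finite marked points and `∞` is affine. -/
theorem affine_of_smul_withInfty {g : GL (Fin 2) ℝ} (hg : 0 < g.det.val) {z z' : Fin n → ℝ}
    (h : (fun i => g • withInfty z i) = withInfty z') :
    ∃ a b : ℝ, 0 < a ∧ z' = fun i => a * z i + b := by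
  have hlast := congrFun h (Fin.last n)
  simp only [withInfty_last, OnePoint.smul_infty_eq_self_iff] at hlast
  have hdet : 0 < g 0 0 * g 1 1 := by
    have : g.det.val = g 0 0 * g 1 1 - g 0 1 * g 1 0 := Matrix.det_fin_two g.1
    rw [this, hlast] at hg
    simpa using hg
  have h11 : g 1 1 ≠ 0 := fun h0 => by simp [h0] at hdet
  refine ⟨g 0 0 / g 1 1, g 0 1 / g 1 1, ?_, ?_⟩
  · have : g 0 0 / g 1 1 = g 0 0 * g 1 1 / (g 1 1) ^ 2 := by field_simp
    rw [this]; positivity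
  · funext i
    have hi := congrFun h i.castSucc
    simp only [withInfty_castSucc, OnePoint.smul_some_eq_ite, hlast, zero_mul, zero_add, h11,
      if_false, OnePoint.coe_eq_coe] at hi
    rw [← hi]
    field_simp

theorem smul_withInfty {a : ℝ} (ha : 0 < a) (z : Fin n → ℝ) :
    ∃ g : GL (Fin 2) ℝ, 0 < g.det.val ∧
      (fun i => g • withInfty z i) = withInfty fun i => a * z i := by
  refine ⟨Matrix.GeneralLinearGroup.mkOfDetNeZero !![a, 0; 0, 1] (by simp [ha.ne']), ?_, ?_⟩
  · simpa [Matrix.GeneralLinearGroup.mkOfDetNeZero] using ha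
  · funext i
    refine Fin.lastCases ?_ (fun i => ?_) i
    · simp [withInfty_last, OnePoint.smul_infty_eq_ite, Matrix.GeneralLinearGroup.mkOfDetNeZero]
    · simp [withInfty_castSucc, OnePoint.smul_some_eq_ite,
        Matrix.GeneralLinearGroup.mkOfDetNeZero]

/-- A function on a marked chamber that is invariant under orientation preserving affine maps
extends to a conformally invariant function of the marked points and `∞`. -/
theorem exists_conformallyInvariant {z₀ : Fin n → ℝ} {G : (Fin n → ℝ) → ℝ}
    (hG : ∀ z ∈ markedChamber z₀, ∀ a b : ℝ, 0 < a → G (fun i => a * z i + b) = G z) :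
    ∃ f : (Fin (n + 1) → OnePoint ℝ) → ℝ, ConformallyInvariant f ∧
      ∀ z ∈ markedChamber z₀, f (withInfty z) = G z := by
  classical
  -- Transport `G` along the Möbius orbits that meet the marked chamber, and put `0` elsewhere.
  let P : (Fin (n + 1) → OnePoint ℝ) → (Fin n → ℝ) → Prop := fun p z =>
    ∃ g : GL (Fin 2) ℝ, 0 < g.det.val ∧ z ∈ markedChamber z₀ ∧ (fun i => g • p i) = withInfty z
  have huniq : ∀ p z z', P p z → P p z' → G z = G z' := by
    rintro p z z' ⟨g, hg, hz, e⟩ ⟨g', hg', hz', e'⟩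
    have hdet : 0 < (g' * g⁻¹).det.val := by
      rw [map_mul, map_inv, Units.val_mul, Units.val_inv_eq_inv_val]
      exact mul_pos hg' (inv_pos.2 hg)
    obtain ⟨a, b, ha, rfl⟩ := affine_of_smul_withInfty hdet (z := z) (z' := z') (by
      rw [← e, ← e']
      funext i
      simp [mul_smul])
    exact (hG z hz a b ha).symm
  have hP : ∀ (g : GL (Fin 2) ℝ), 0 < g.det.val → ∀ p z, P p z → P (fun i => g • p i) z := by
    rintro g hg p z ⟨g', hg', hz, e⟩
    refine ⟨g' * g⁻¹, ?_, hz, ?_⟩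
    · rw [map_mul, map_inv, Units.val_mul, Units.val_inv_eq_inv_val]
      exact mul_pos hg' (inv_pos.2 hg)
    · rw [← e]
      funext i
      simp [mul_smul]
  have hval : ∀ p z, P p z → (if h : ∃ z, P p z then G h.choose else 0) = G z := by
    intro p z hz
    have hex : ∃ z, P p z := ⟨z, hz⟩
    rw [dif_pos hex]
    exact huniq p _ _ hex.choose_spec hz
  refine ⟨fun p => if h : ∃ z, P p z then G h.choose else 0, fun g hg p => ?_, fun z hz => ?_⟩
  · by_cases hex : ∃ z, P p z
    · obtain ⟨z, hz⟩ := hex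
      exact (hval _ z (hP g hg p z hz)).trans (hval p z hz).symm
    · have hex' : ¬ ∃ z, P (fun i => g • p i) z := by
        rintro ⟨z, hz⟩
        refine hex ⟨z, ?_⟩
        have hdet : 0 < (g⁻¹).det.val := by
          rw [map_inv, Units.val_inv_eq_inv_val]
          exact inv_pos.2 hg
        have := hP g⁻¹ hdet _ z hz
        simpa using this
      simp only [dif_neg hex, dif_neg hex']
  · exact hval _ z ⟨1, by simp, hz, by simp⟩

end

/-! ### Weight vectors of a normal form -/

section

variable {n : ℕ}

/-- The logarithm of `∏ |z_i - z_j| ^ (2 ν_ij)`, as a sum over ordered pairs of finite marked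
points. The diagonal terms are `0`. -/
noncomputable def logProduct (ν : Pair n → ℝ) (z : Fin n → ℝ) : ℝ :=
  ∑ i : Fin n, ∑ j : Fin n, symMatrix ν i.castSucc j.castSucc * Real.log (z i - z j)

/-- Twice the sum of the weights of the pairs of finite marked points. -/
def finiteSum (ν : Pair n → ℝ) : ℝ :=
  ∑ i : Fin n, ∑ j : Fin n, symMatrix ν i.castSucc j.castSucc

theorem sum_vertexSum (ν : Pair n → ℝ) :
    ∑ i : Fin n, vertexSum ν i.castSucc = finiteSum ν + vertexSum ν (Fin.last n) := by
  simp only [vertexSum, Fin.sum_univ_castSucc, Finset.sum_add_distrib, symMatrix_self, add_zero,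
    finiteSum, symMatrix_comm ν (Fin.last n)]

theorem contDiffAt_logProduct (ν : Pair n → ℝ) {z : Fin n → ℝ} (hz : Function.Injective z) :
    ContDiffAt ℝ ∞ (logProduct ν) z := by
  have hco : ∀ i : Fin n, ContDiffAt ℝ ∞ (fun z : Fin n → ℝ => z i) z := fun i =>
    (ContinuousLinearMap.proj (R := ℝ) (φ := fun _ : Fin n => ℝ) i).contDiff.contDiffAt
  refine ContDiffAt.sum fun i _ => ContDiffAt.sum fun j _ => ?_
  by_cases h : i = j
  · subst h
    simpa [symMatrix_self] using contDiffAt_const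
  · exact contDiffAt_const.mul (((hco i).sub (hco j)).log (sub_ne_zero.2 (hz.ne h)))

theorem pderiv_logProduct (ν : Pair n → ℝ) {z : Fin n → ℝ} (hz : Function.Injective z)
    (l : Fin n) : pderiv l (logProduct ν) z = ∑ i : Fin n, ∑ j : Fin n,
      symMatrix ν i.castSucc j.castSucc *
        (((if i = l then 1 else 0) - if j = l then 1 else 0) / (z i - z j)) := by
  have hc : ∀ i, HasDerivAt (fun t => Function.update z l t i) (if i = l then 1 else 0)
      (z l) := by
    intro i
    by_cases h : i = l
    · subst h; simpa using hasDerivAt_id' (z i)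
    · simpa [h] using hasDerivAt_const (z l) (z i)
  refine (HasDerivAt.fun_sum fun i _ => HasDerivAt.fun_sum fun j _ => ?_).deriv
  by_cases h : i = j
  · subst h
    simpa [symMatrix_self] using hasDerivAt_const (z l) (0 : ℝ)
  · have h1 := ((hc i).sub (hc j)).log (by
      simpa only [Pi.sub_apply, Function.update_eq_self] using sub_ne_zero.2 (hz.ne h))
    simpa only [Pi.sub_apply, Function.update_eq_self] using
      h1.const_mul (symMatrix ν i.castSucc j.castSucc)

theorem markedFlow_logProduct (ν : Pair n → ℝ) {z : Fin n → ℝ} (hz : Function.Injective z) {x : ℝ}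
    (hx : ∀ i, z i ≠ x) : markedFlow x (logProduct ν) z = ∑ i : Fin n, ∑ j : Fin n,
      symMatrix ν i.castSucc j.castSucc * (-2 * (1 / (x - z i) * (1 / (x - z j)))) := by
  simp only [markedFlow, pderiv_logProduct ν hz, Finset.mul_sum]
  rw [Finset.sum_comm]
  refine Finset.sum_congr rfl fun i _ => ?_
  rw [Finset.sum_comm]
  refine Finset.sum_congr rfl fun j _ => ?_
  have h1 : z i - x ≠ 0 := sub_ne_zero.2 (hx i)
  have h2 : z j - x ≠ 0 := sub_ne_zero.2 (hx j)
  have h3 : x - z i ≠ 0 := sub_ne_zero.2 (hx i).symm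
  have h4 : x - z j ≠ 0 := sub_ne_zero.2 (hx j).symm
  have e : ∀ l, 2 / (z l - x) * (symMatrix ν i.castSucc j.castSucc *
      (((if i = l then 1 else 0) - if j = l then 1 else 0) / (z i - z j))) =
      (if i = l then symMatrix ν i.castSucc j.castSucc * (2 / (z l - x) / (z i - z j)) else 0) -
        if j = l then symMatrix ν i.castSucc j.castSucc * (2 / (z l - x) / (z i - z j)) else 0 := by
    intro l; split_ifs <;> ring
  simp only [e, Finset.sum_sub_distrib, Finset.sum_ite_eq, Finset.mem_univ, if_true]
  by_cases h : i = j
  · subst h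
    simp [symMatrix_self]
  · have h5 : z i - z j ≠ 0 := sub_ne_zero.2 (hz.ne h)
    field_simp
    ring

theorem logProduct_add (ν : Pair n → ℝ) (z : Fin n → ℝ) (c : ℝ) :
    logProduct ν (fun i => z i + c) = logProduct ν z := by
  simp only [logProduct, add_sub_add_right_eq_sub]

theorem logProduct_mul (ν : Pair n → ℝ) {z : Fin n → ℝ} (hz : Function.Injective z) {r : ℝ}
    (hr : 0 < r) : logProduct ν (fun i => r * z i) = logProduct ν z + finiteSum ν * Real.log r := by
  simp only [logProduct, finiteSum, Finset.sum_mul, ← Finset.sum_add_distrib]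
  refine Finset.sum_congr rfl fun i _ => Finset.sum_congr rfl fun j _ => ?_
  by_cases h : i = j
  · subst h; simp [symMatrix_self]
  · rw [← mul_sub, Real.log_mul hr.ne' (sub_ne_zero.2 (hz.ne h))]
    ring

theorem recip_castSucc (x : ℝ) (z : Fin n → ℝ) (i : Fin n) :
    recip x z i.castSucc = 1 / (x - z i) := by simp [recip]

theorem recip_last (x : ℝ) (z : Fin n → ℝ) : recip x z (Fin.last n) = 0 := by simp [recip]

/-- The weight function: its double poles are given by the vertex sums, and the remaining products
of two simple poles are the Loewner derivative of `logProduct`. -/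
theorem weight_eq (ν : Pair n → ℝ) (f : (Fin (n + 1) → OnePoint ℝ) → ℝ) {z : Fin n → ℝ}
    (hz : Function.Injective z) {x : ℝ} (hx : ∀ i, z i ≠ x) :
    weight ν f x z = ∑ i : Fin n, 2 * vertexSum ν i.castSucc / (x - z i) ^ 2 +
      markedFlow x (logProduct ν) z + markedFlow x (fun u => Real.log (f (withInfty u))) z := by
  rw [weight, markedFlow_logProduct ν hz hx]
  congr 1
  have e := two_mul_pair_sum ν (F := fun i j => (recip x z i - recip x z j) ^ 2)
    (fun i j => by ring)
  have e1 : ∑ p : Pair n, 2 * ν p * (recip x z p.1.1 - recip x z p.1.2) ^ 2 =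
      2 * ∑ p : Pair n, ν p * (recip x z p.1.1 - recip x z p.1.2) ^ 2 := by
    rw [Finset.mul_sum]
    exact Finset.sum_congr rfl fun p _ => by ring
  have e2 : ∀ i j, symMatrix ν i j * (recip x z i - recip x z j) ^ 2 =
      symMatrix ν i j * recip x z i ^ 2 + symMatrix ν j i * recip x z j ^ 2 +
        symMatrix ν i j * (-2 * (recip x z i * recip x z j)) := by
    intro i j
    rw [symMatrix_comm ν j i]; ring
  have e3 : ∑ i, ∑ j, symMatrix ν j i * recip x z j ^ 2 =
      ∑ i, ∑ j, symMatrix ν i j * recip x z i ^ 2 := Finset.sum_comm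
  rw [e1, e]
  simp only [e2, Finset.sum_add_distrib]
  rw [e3]
  simp only [← Finset.sum_mul]
  rw [← two_mul, Finset.mul_sum, Fin.sum_univ_castSucc]
  simp only [recip_last, ne_eq, OfNat.ofNat_ne_zero, not_false_eq_true, zero_pow, mul_zero,
    add_zero, Fin.sum_univ_castSucc, zero_mul, Finset.sum_const_zero, recip_castSucc]
  congr 1
  refine Finset.sum_congr rfl fun i _ => ?_
  rw [vertexSum, Fin.sum_univ_castSucc, div_pow, one_pow]
  ring

theorem pderiv_sub {f g : (Fin n → ℝ) → ℝ} {z : Fin n → ℝ} (hf : DifferentiableAt ℝ f z)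
    (hg : DifferentiableAt ℝ g z) (l : Fin n) :
    pderiv l (fun u => f u - g u) z = pderiv l f z - pderiv l g z :=
  ((hasDerivAt_comp_update hf l).sub (hasDerivAt_comp_update hg l)).deriv

variable {w₀ : Config n} {h₁ h₂ : ℝ → (Fin n → ℝ) → ℝ} {α : Fin n → ℝ} {L : (Fin n → ℝ) → ℝ}
  {e : ℝ}

/-- A vector is a weight vector if and only if its vertex sums at the finite points give the double
poles, and twice its total weight on the pairs of finite points is the degree of homogeneity. -/
theorem NormalForm.hasWeights_iff (H : NormalForm w₀ h₁ h₂ α L e)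
    (hw₀ : Function.Injective (pts w₀)) (ν : Pair n → ℝ) :
    HasWeights w₀ h₁ h₂ ν ↔ (∀ i : Fin n, 2 * vertexSum ν i.castSucc = α i) ∧ finiteSum ν = e := by
  have hinj : ∀ z ∈ markedChamber w₀.2.2, Function.Injective z := fun z hz =>
    injective_of_mem_markedChamber (injective_marked hw₀) hz
  have hz₀ : w₀.2.2 ∈ markedChamber w₀.2.2 := fun _ _ h => h
  have hopen := isOpen_markedChamber w₀.2.2
  have hLd : ∀ z ∈ markedChamber w₀.2.2, DifferentiableAt ℝ L z := fun z hz =>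
    (H.smooth.contDiffAt (hopen.mem_nhds hz)).differentiableAt (by simp)
  have hPd : ∀ z ∈ markedChamber w₀.2.2, DifferentiableAt ℝ (logProduct ν) z := fun z hz =>
    (contDiffAt_logProduct ν (hinj z hz)).differentiableAt (by simp)
  constructor
  · rintro ⟨f, hf, hpos, hsm, heq⟩
    set G : (Fin n → ℝ) → ℝ := fun u => Real.log (f (withInfty u)) with hG
    have hGd : ∀ z ∈ markedChamber w₀.2.2, DifferentiableAt ℝ G z := fun z hz =>
      ((hsm.contDiffAt (hopen.mem_nhds hz)).log (hpos z hz).ne').differentiableAt (by simp)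
    have key : ∀ z ∈ markedChamber w₀.2.2, ∀ i : Fin n, 2 * vertexSum ν i.castSucc = α i ∧
        pderiv i L z = pderiv i (logProduct ν) z + pderiv i G z := by
      intro z hz i
      obtain ⟨x, y, hw⟩ := exists_mem_chamber hz
      obtain ⟨I, hI, J, hJ, V, hV, h⟩ := exists_box hw
      have h' := fun x' hx' => h x' hx' y (mem_of_mem_nhds hJ) z (mem_of_mem_nhds hV)
      have ind := pole_independent (hinj z hz) (infinite_of_mem_nhds _ hI)
        (fun x' hx' i => ((distinct hw₀ (h' x' hx')).2.1 i).symm) 2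
        (fun i s => if s = 0 then
            2 * (pderiv i (logProduct ν) z + pderiv i G z - pderiv i L z)
          else α i - 2 * vertexSum ν i.castSucc) (fun x' hx' => by
          have hx := (distinct hw₀ (h' x' hx')).2.1
          have e1 := (H.eq x' y z (h' x' hx')).1
          rw [(heq x' y z (h' x' hx')).1, weight_eq ν f (hinj z hz) hx] at e1
          simp only [markedFlow, ← Finset.sum_add_distrib] at e1
          rw [← sub_eq_zero, ← Finset.sum_sub_distrib] at e1
          rw [← neg_eq_zero, ← e1, ← Finset.sum_neg_distrib]
          refine Finset.sum_congr rfl fun i _ => ?_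
          have g1 : z i - x' ≠ 0 := sub_ne_zero.2 (hx i)
          have g2 : x' - z i ≠ 0 := sub_ne_zero.2 (hx i).symm
          simp only [Finset.sum_range_succ, Finset.sum_range_zero, zero_add, if_true, one_ne_zero,
            if_false, pow_one, Nat.reduceAdd]
          field_simp
          ring)
      have i0 := ind i 0 (by norm_num)
      have i1 := ind i 1 (by norm_num)
      simp only [if_true, one_ne_zero, if_false] at i0 i1
      exact ⟨by linarith, by linarith⟩
    refine ⟨fun i => (key _ hz₀ i).1, ?_⟩
    -- The difference of the two potentials is constant; compare its values at `z` and `2 z`.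
    have h2 : (fun i => 2 * w₀.2.2 i) ∈ markedChamber w₀.2.2 := mul_mem_markedChamber hz₀ two_pos
    have hconst := eq_of_pderiv_eq_zero (g := fun u => L u - logProduct ν u - G u)
      (fun z hz => ((hLd z hz).sub (hPd z hz)).sub (hGd z hz)) (fun z hz i => by
        rw [pderiv_sub ((hLd z hz).fun_sub (hPd z hz)) (hGd z hz),
          pderiv_sub (hLd z hz) (hPd z hz), (key z hz i).2]
        ring) h2 hz₀
    have hG2 : G (fun i => 2 * w₀.2.2 i) = G w₀.2.2 := by
      obtain ⟨g, hg, hg2⟩ := smul_withInfty two_pos w₀.2.2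
      simp only [hG, ← hg2, hf g hg]
    rw [hG2, logProduct_mul ν (hinj _ hz₀) two_pos, H.dil _ hz₀ 2 two_pos] at hconst
    have hlog : Real.log 2 ≠ 0 := (Real.log_pos one_lt_two).ne'
    refine mul_right_cancel₀ hlog ?_
    linarith
  · rintro ⟨hv, he⟩
    have hinv : ∀ z ∈ markedChamber w₀.2.2, ∀ a b : ℝ, 0 < a →
        Real.exp (L (fun i => a * z i + b) - logProduct ν (fun i => a * z i + b)) =
          Real.exp (L z - logProduct ν z) := by
      intro z hz a b ha
      rw [H.trans _ (mul_mem_markedChamber hz ha) b, logProduct_add ν (fun i => a * z i) b,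
        logProduct_mul ν (hinj z hz) ha, H.dil z hz a ha, he]
      congr 1
      ring
    obtain ⟨f, hf, hval⟩ := exists_conformallyInvariant
      (G := fun z => Real.exp (L z - logProduct ν z)) hinv
    have hflow : ∀ z ∈ markedChamber w₀.2.2, ∀ x,
        markedFlow x (logProduct ν) z + markedFlow x (fun u => Real.log (f (withInfty u))) z =
          markedFlow x L z := by
      intro z hz x
      simp only [markedFlow, ← Finset.sum_add_distrib, ← mul_add]
      refine Finset.sum_congr rfl fun i _ => ?_
      have : (fun u => Real.log (f (withInfty u))) =ᶠ[𝓝 z] fun u => L u - logProduct ν u := by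
        filter_upwards [hopen.mem_nhds hz] with u hu
        rw [hval u hu, Real.log_exp]
      rw [pderiv_congr this, pderiv_sub (hLd z hz) (hPd z hz)]
      ring
    refine ⟨f, hf, fun z hz => ?_, ?_, fun x y z hw => ?_⟩
    · rw [hval z hz]; exact Real.exp_pos _
    · have hs : ContDiffOn ℝ ∞ (fun z => Real.exp (L z - logProduct ν z))
          (markedChamber w₀.2.2) := fun z hz =>
        ((H.smooth z hz).sub (contDiffAt_logProduct ν (hinj z hz)).contDiffWithinAt).exp
      exact hs.congr hval
    · have hz := mem_markedChamber hw
      obtain ⟨-, hzx, hzy, -⟩ := distinct hw₀ hw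
      rw [weight_eq ν f (hinj z hz) hzx, weight_eq ν f (hinj z hz) hzy, add_assoc, add_assoc,
        hflow z hz, hflow z hz]
      simp only [hv]
      exact H.eq x y z hw

/-- With at most one finite marked point, the degree of homogeneity vanishes, as a dilation then
acts as a translation. -/
theorem NormalForm.degree_eq_zero (H : NormalForm w₀ h₁ h₂ α L e) (hn : n ≤ 1) : e = 0 := by
  have hz₀ : w₀.2.2 ∈ markedChamber w₀.2.2 := fun _ _ h => h
  have hd := H.dil _ hz₀ 2 two_pos
  obtain ⟨c, hc⟩ : ∃ c, (fun i => 2 * w₀.2.2 i) = fun i => w₀.2.2 i + c := by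
    rcases Nat.le_one_iff_eq_zero_or_eq_one.1 hn with rfl | rfl
    · exact ⟨0, Subsingleton.elim _ _⟩
    · refine ⟨w₀.2.2 0, funext fun i => ?_⟩
      rw [Subsingleton.elim i 0]
      ring
  rw [hc, H.trans _ hz₀] at hd
  have hlog : Real.log 2 ≠ 0 := (Real.log_pos one_lt_two).ne'
  exact (mul_eq_zero.1 (by linarith : e * Real.log 2 = 0)).resolve_right hlog

theorem NormalForm.exists_weights (H : NormalForm w₀ h₁ h₂ α L e) :
    ∃ ν : Pair n → ℝ, (∀ i : Fin n, 2 * vertexSum ν i.castSucc = α i) ∧ finiteSum ν = e := by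
  by_cases hn : 2 ≤ n
  · obtain ⟨ν, hν⟩ := exists_vertexSum hn
      (Fin.snoc (α := fun _ => ℝ) (fun i => α i / 2) ((∑ i, α i) / 2 - e))
    have h1 : ∀ i : Fin n, vertexSum ν i.castSucc = α i / 2 := fun i => by simp [hν]
    refine ⟨ν, fun i => by rw [h1]; ring, ?_⟩
    have := sum_vertexSum ν
    simp only [h1, hν, Fin.snoc_last, ← Finset.sum_div] at this
    linarith
  · rw [H.degree_eq_zero (by omega)]
    have hn' : n = 0 ∨ n = 1 := by omega
    rcases hn' with rfl | rfl
    · exact ⟨0, fun i => i.elim0, by simp [finiteSum]⟩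
    · refine ⟨fun _ => α 0 / 2, fun i => ?_, ?_⟩
      · rw [Subsingleton.elim i 0]
        simp [vertexSum, Fin.sum_univ_two, symMatrix]
        ring
      · simp [finiteSum, symMatrix_self]

end

end SLECommutation

theorem lemma4 (n : ℕ) (κ κ' : ℝ) (hκ : 0 < κ) (hκ' : 0 < κ')
    (w₀ : SLECommutation.Config n) (hw₀ : Function.Injective (SLECommutation.pts w₀))
    (h₁ h₂ : ℝ → (Fin n → ℝ) → ℝ) (ψ : SLECommutation.Config n → ℝ)
    (hsmooth : ContDiffOn ℝ (⊤ : ℕ∞) ψ (SLECommutation.chamber w₀))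
    (hne : ∀ w ∈ SLECommutation.chamber w₀, ψ w ≠ 0)
    (htrans : ∀ (c x y : ℝ) (z : Fin n → ℝ), (x, y, z) ∈ SLECommutation.chamber w₀ →
      ψ (x + c, y + c, fun i => z i + c) = ψ (x, y, z))
    (d : ℝ)
    (hhom : ∀ (r x y : ℝ) (z : Fin n → ℝ), 0 < r → (x, y, z) ∈ SLECommutation.chamber w₀ →
      ψ (r * x, r * y, fun i => r * z i) = r ^ d * ψ (x, y, z))
    (hsol : SLECommutation.IsSolution κ κ' h₁ h₂ (SLECommutation.chamber w₀) ψ) :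
    (κ' = κ ∨ κ' = 16 / κ) ∧
    (∃ ν : SLECommutation.Pair n → ℝ, SLECommutation.HasWeights w₀ h₁ h₂ ν) ∧
    (∀ ν ν' : SLECommutation.Pair n → ℝ, SLECommutation.HasWeights w₀ h₁ h₂ ν →
      (SLECommutation.HasWeights w₀ h₁ h₂ ν' ↔ ν' - ν ∈ SLECommutation.relations n)) := by
  have hsep := fun {x y : ℝ} {z : Fin n → ℝ} (hw : (x, y, z) ∈ SLECommutation.chamber w₀) =>
    SLECommutation.separated_pointwise hκ hκ' hw₀ hsmooth hne htrans d hhom hsol hw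
  have hC := SLECommutation.separated_constant_eq_zero hw₀ fun hw => (hsep hw).2.2.2.2
  obtain ⟨α, L, e, H⟩ := SLECommutation.exists_normalForm hw₀ fun {x y z} hw => by
    obtain ⟨s1, s2, s3, s4, s5⟩ := hsep hw
    rw [hC, zero_div, sub_eq_zero] at s5
    exact ⟨s1, s2, s3, s4, s5⟩
  refine ⟨?_, ?_, fun ν ν' hν => ?_⟩
  · have hprod : (κ' - κ) * (κ * κ' - 16) = 0 := by
      field_simp at hC
      linear_combination hC / 3
    rcases mul_eq_zero.1 hprod with h | h
    · exact Or.inl (sub_eq_zero.1 h)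
    · refine Or.inr ((eq_div_iff hκ.ne').2 ?_)
      linarith
  · obtain ⟨ν, hν⟩ := H.exists_weights
    exact ⟨ν, (H.hasWeights_iff hw₀ ν).2 hν⟩
  · obtain ⟨hv, hf⟩ := (H.hasWeights_iff hw₀ ν).1 hν
    rw [H.hasWeights_iff hw₀, SLECommutation.mem_relations_iff]
    have s := SLECommutation.sum_vertexSum ν
    have s' := SLECommutation.sum_vertexSum ν'
    constructor
    · rintro ⟨hv', hf'⟩ i
      rw [SLECommutation.vertexSum_sub, sub_eq_zero]
      have hfin : ∀ i : Fin n, SLECommutation.vertexSum ν' i.castSucc =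
          SLECommutation.vertexSum ν i.castSucc := fun i => by linarith [hv i, hv' i]
      refine Fin.lastCases ?_ hfin i
      simp only [hfin] at s'
      linarith
    · intro h
      have hall : ∀ i, SLECommutation.vertexSum ν' i = SLECommutation.vertexSum ν i := fun i => by
        have := h i
        rw [SLECommutation.vertexSum_sub] at this
        linarith
      simp only [hall] at s' ⊢
      exact ⟨hv, by linarith⟩
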